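/- Let $n\ge 1$, $0<s<1$ and let $\Omega\subset\mathbb R^n$ be open. Set $$\gamma(a)=\frac{\pi^{n/2}2^{a}\Gamma(a/2)}{\Gamma((n-a)/2)},\qquad c_{n,s}=\frac{n-1+s}{\gamma(1-s)},\qquad k_s(z)=\frac{z}{|z|}\,\frac1{|z|^{n-1+s}} .$$ For a scalar function $u$, a vector field $w:\mathbb R^n\to\mathbb R^n$ and a matrix field $\Phi:\mathbb R^n\to\mathbb R^{n\times n}$ define, whenever the integrals converge absolutely, $$D^su(x)=c_{n,s}\int_{\mathbb R^n}\frac{u(x)-u(y)}{|x-y|}\,k_s(x-y)\,dy,\qquad D^sw(x)=c_{n,s}\int_{\mathbb R^n}\frac{w(x)-w(y)}{|x-y|}\otimes k_s(x-y)\,dy,$$ $$\operatorname{div}^sw(x)=c_{n,s}\int_{\mathbb R^n}\frac{w(x)-w(y)}{|x-y|}\cdot k_s(x-y)\,dy,\qquad \operatorname{div}^s\Phi(x)=c_{n,s}\int_{\mathbb R^n}\frac{\Phi(x)-\Phi(y)}{|x-y|}\,k_s(x-y)\,dy,$$ and let $\Delta^s=-(-\Delta)^s$ be the fractional Laplacian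 $$\Delta^sw(x)=\frac{4^s\,s\,\Gamma(\frac n2+s)}{\pi^{n/2}\,\Gamma(1-s)}\ \lim_{\varepsilon\downarrow0}\int_{|x-y|\ge\varepsilon}\frac{w(y)-w(x)}{|x-y|^{n+2s}}\,dy .$$ Let $v\in C_c^\infty(\Omega,\mathbb R^n)$, extended by zero to $\mathbb R^n$. Then all the integrals occurring below converge absolutely at every $x\in\mathbb R^n$, the limit defining $\Delta^sv(x)$ exists (its truncated integrals being absolutely convergent), and everywhere in $\mathbb R^n$ $$\operatorname{tr}D^sv=\operatorname{div}^sv,\qquad \operatorname{div}^s\big((\operatorname{div}^sv)I\big)=D^s(\operatorname{div}^sv),$$ $$\operatorname{div}^sD^sv=\Delta^sv,\qquad \operatorname{div}^s(D^sv)^T=D^s(\operatorname{div}^sv).$$ Consequently, for all $\mu,\lambda\in\mathbb R$, with $Ce=2\mu e+\lambda(\operatorname{tr}e)I$ and $D^s_{\rm sym}v=\frac12\big(D^sv+(D^sv)^T\big)$, $$\operatorname{div}^s(C D^s_{\rm sym}v)=\mu\,\Delta^sv+(\mu+\lambda)\,D^s(\operatorname{div}^sv)\quad\text{in }\mathbb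 R^n,$$ so that, for every $f:\Omega\to\mathbb R^n$, $v$ satisfies $-\operatorname{div}^s(CD^s_{\rm sym}v)=f$ in $\Omega$, $v=0$ in $\Omega^c$, if and only if it satisfies the strong isotropic fractional Navier system $-\mu\Delta^sv-(\mu+\lambda)D^s(\operatorname{div}^sv)=f$ in $\Omega$, $v=0$ in $\Omega^c$. -/

import Mathlib

open Real Set Filter Topology MeasureTheory
open scoped ContDiff Matrix

noncomputable section

namespace FracElasticity

/-- The normalising factor `γ(a)` of the Riesz potential of order `a` in dimension `n`. -/
def rieszGamma (n : ℕ) (a : ℝ) : ℝ :=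
  π ^ ((n : ℝ) / 2) * 2 ^ a * Real.Gamma (a / 2) / Real.Gamma (((n : ℝ) - a) / 2)

/-- The constant `c_{n,s} = (n - 1 + s) / γ(1 - s)`. -/
def rieszConst (n : ℕ) (s : ℝ) : ℝ :=
  ((n : ℝ) - 1 + s) / rieszGamma n (1 - s)

/-- The vector kernel `z ↦ (z / |z|) * (1 / |z|^(n-1+s))`. -/
def rieszKernel {n : ℕ} (s : ℝ) (z : EuclideanSpace ℝ (Fin n)) : EuclideanSpace ℝ (Fin n) :=
  (1 / ‖z‖ ^ ((n : ℝ) - 1 + s)) • (‖z‖⁻¹ • z)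

/-- The integrand (in `y`) of the fractional gradient of a scalar function at `x`. -/
def gradIntegrand {n : ℕ} (s : ℝ) (u : EuclideanSpace ℝ (Fin n) → ℝ)
    (x y : EuclideanSpace ℝ (Fin n)) : EuclideanSpace ℝ (Fin n) :=
  ((u x - u y) / ‖x - y‖) • rieszKernel s (x - y)

/-- Riesz' `s`-fractional gradient of a scalar function. -/
def fracGrad {n : ℕ} (s : ℝ) (u : EuclideanSpace ℝ (Fin n) → ℝ)
    (x : EuclideanSpace ℝ (Fin n)) : EuclideanSpace ℝ (Fin n) :=
  rieszConst n s • ∫ y, gradIntegrand s u x y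

/-- The matrix-valued integrand of the fractional gradient of a vector field:
`(u x - u y) / |x - y|` tensored with the kernel. -/
def vecGradIntegrand {n : ℕ} (s : ℝ) (u : EuclideanSpace ℝ (Fin n) → EuclideanSpace ℝ (Fin n))
    (x y : EuclideanSpace ℝ (Fin n)) : Matrix (Fin n) (Fin n) ℝ :=
  Matrix.vecMulVec (‖x - y‖⁻¹ • (u x - u y)).ofLp (rieszKernel s (x - y)).ofLp

/-- Riesz' `s`-fractional gradient of a vector field (the matrix is integrated entrywise). -/
def vecFracGrad {n : ℕ} (s : ℝ) (u : EuclideanSpace ℝ (Fin n) → EuclideanSpace ℝ (Fin n))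
    (x : EuclideanSpace ℝ (Fin n)) : Matrix (Fin n) (Fin n) ℝ :=
  Matrix.of fun i j => rieszConst n s * ∫ y, vecGradIntegrand s u x y i j

/-- The integrand (in `y`) of the fractional divergence of a vector field at `x`. -/
def divIntegrand {n : ℕ} (s : ℝ) (u : EuclideanSpace ℝ (Fin n) → EuclideanSpace ℝ (Fin n))
    (x y : EuclideanSpace ℝ (Fin n)) : ℝ :=
  inner ℝ (‖x - y‖⁻¹ • (u x - u y)) (rieszKernel s (x - y))

/-- The `s`-fractional divergence of a vector field. -/
def fracDiv {n : ℕ} (s : ℝ) (u : EuclideanSpace ℝ (Fin n) → EuclideanSpace ℝ (Fin n))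
    (x : EuclideanSpace ℝ (Fin n)) : ℝ :=
  rieszConst n s * ∫ y, divIntegrand s u x y

/-- The integrand (in `y`) of the fractional divergence of a matrix field at `x`. -/
def matDivIntegrand {n : ℕ} (s : ℝ)
    (Φ : EuclideanSpace ℝ (Fin n) → Matrix (Fin n) (Fin n) ℝ)
    (x y : EuclideanSpace ℝ (Fin n)) : EuclideanSpace ℝ (Fin n) :=
  WithLp.toLp 2 ((‖x - y‖⁻¹ • (Φ x - Φ y)) *ᵥ (rieszKernel s (x - y)).ofLp)

/-- The (row-wise) `s`-fractional divergence of a matrix field. -/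
def matFracDiv {n : ℕ} (s : ℝ)
    (Φ : EuclideanSpace ℝ (Fin n) → Matrix (Fin n) (Fin n) ℝ)
    (x : EuclideanSpace ℝ (Fin n)) : EuclideanSpace ℝ (Fin n) :=
  rieszConst n s • ∫ y, matDivIntegrand s Φ x y

/-- The constant of the fractional Laplacian of order `2 s`, for which its Fourier symbol
is `-(2 π |ξ|)^(2 s)`; it equals `4^s Γ(n/2 + s) / (π^(n/2) |Γ(-s)|)`. -/
def lapConst (n : ℕ) (s : ℝ) : ℝ :=
  4 ^ s * s * Real.Gamma ((n : ℝ) / 2 + s) / (π ^ ((n : ℝ) / 2) * Real.Gamma (1 - s))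

/-- The integrand (in `y`) of the fractional Laplacian at `x`. -/
def lapIntegrand {n : ℕ} (s : ℝ) (u : EuclideanSpace ℝ (Fin n) → EuclideanSpace ℝ (Fin n))
    (x y : EuclideanSpace ℝ (Fin n)) : EuclideanSpace ℝ (Fin n) :=
  (1 / ‖x - y‖ ^ ((n : ℝ) + 2 * s)) • (u y - u x)

/-- The fractional Laplacian with the ball of radius `ε` around the singularity removed. -/
def truncLap {n : ℕ} (s : ℝ) (u : EuclideanSpace ℝ (Fin n) → EuclideanSpace ℝ (Fin n))
    (x : EuclideanSpace ℝ (Fin n)) (ε : ℝ) : EuclideanSpace ℝ (Fin n) :=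
  lapConst n s • ∫ y in (Metric.ball x ε)ᶜ, lapIntegrand s u x y

/-- The fractional Laplacian `Δ^s = -(-Δ)^s`, as a principal value. -/
def fracLap {n : ℕ} (s : ℝ) (u : EuclideanSpace ℝ (Fin n) → EuclideanSpace ℝ (Fin n))
    (x : EuclideanSpace ℝ (Fin n)) : EuclideanSpace ℝ (Fin n) :=
  limUnder (𝓝[>] (0 : ℝ)) (truncLap s u x)

/-- The symmetric part of a square matrix. -/
def symPart {n : ℕ} (H : Matrix (Fin n) (Fin n) ℝ) : Matrix (Fin n) (Fin n) ℝ :=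
  (1 / 2 : ℝ) • (H + Hᵀ)

/-- The isotropic elasticity tensor with Lamé moduli `mu`, `lam`. -/
def isoTensor {n : ℕ} (mu lam : ℝ) (e : Matrix (Fin n) (Fin n) ℝ) :
    Matrix (Fin n) (Fin n) ℝ :=
  (2 * mu) • e + (lam * e.trace) • (1 : Matrix (Fin n) (Fin n) ℝ)

end FracElasticity

end

/-! The identities are statements about Fourier multipliers. On the plane wave with frequency ξ, the
fractional derivative in direction a multiplies by i (2π)^s |ξ|^(s-1) ⟨a,ξ⟩, and Δ^s multiplies by
-(2π|ξ|)^(2s). Summing the squares of the symbols over the coordinate directions gives the symbol of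
Δ^s, whence div^s D^s = Δ^s. Because symbols commute, div^s (D^s v)^T = D^s (div^s v). The trace
identity and the one for (div^s v) I are seen on the integrands, and the Navier form follows by
linearity.

Two points need work. The symbols must come out with exactly the stated constants: negative powers
of |z| are written as superpositions of Gaussians, whose Fourier transforms are explicit, and the
remaining one-dimensional integrals are Gamma integrals (`rieszConst_mul_integral_dirKernel`,
`lapConst_mul_integral`). The operators must also be iterated on functions for which compact support
is no longer available. For this, `HasSpectrum` records that a function is a superposition of plane
waves whose density has k absolute moments. Fubini against the singular kernel is justified by |1 -
e^(2πi⟨z,ξ⟩)| ≤ C (1+|ξ|) min(1,|z|), and each derivative costs one moment (`HasSpectrum.dirDeriv`).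
The principal value is handled by symmetrising to second differences
(`HasSpectrum.tendsto_truncated`). -/

namespace FracElasticity

/-! ### One-dimensional Gamma-type integrals. -/

section OneDim

/-- An inverse-variable form of the Gamma integral. -/
theorem integral_rpow_mul_exp_neg_div {a β : ℝ} (ha : 0 < a) (hβ : 0 < β) :
    ∫ t in Ioi (0 : ℝ), t ^ (-a - 1) * Real.exp (-(β / t)) = β ^ (-a) * Real.Gamma a := by
  have h := integral_comp_rpow_Ioi (fun r : ℝ => r ^ (a - 1) * Real.exp (-(β * r)))
    (p := -1) (by norm_num)
  rw [Real.integral_rpow_mul_exp_neg_mul_Ioi ha hβ, one_div, Real.inv_rpow hβ.le,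
    ← Real.rpow_neg hβ.le] at h
  rw [← h]
  refine setIntegral_congr_fun measurableSet_Ioi fun t ht => ?_
  have ht : 0 < t := ht
  simp only [smul_eq_mul, abs_neg, abs_one, one_mul]
  rw [← Real.rpow_mul ht.le, Real.rpow_neg_one t, ← div_eq_mul_inv, ← mul_assoc,
    ← Real.rpow_add ht]
  congr 2
  ring

theorem integrableOn_rpow_mul_one_sub_exp {s β : ℝ} (hs0 : 0 < s) (hs1 : s < 1) (hβ : 0 < β) :
    IntegrableOn (fun r : ℝ => r ^ (-s - 1) * (1 - Real.exp (-(β * r)))) (Ioi 0) := by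
  have hm : ∀ S : Set ℝ, AEStronglyMeasurable
      (fun r : ℝ => r ^ (-s - 1) * (1 - Real.exp (-(β * r)))) (volume.restrict S) :=
    fun S => Measurable.aestronglyMeasurable (by fun_prop)
  rw [← Ioc_union_Ioi_eq_Ioi zero_le_one]
  refine IntegrableOn.union ?_ ?_
  · have h1 : IntegrableOn (fun r : ℝ => β * r ^ (-s)) (Ioc 0 1) := by
      refine Integrable.const_mul ?_ _
      have := (intervalIntegral.intervalIntegrable_rpow' (a := 0) (b := 1)
        (show (-1 : ℝ) < -s by linarith))
      exact (intervalIntegrable_iff_integrableOn_Ioc_of_le zero_le_one).1 this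
    refine h1.mono' (hm _) ?_
    refine (ae_restrict_iff' measurableSet_Ioc).2 (.of_forall fun r hr => ?_)
    have hr0 : 0 < r := hr.1
    have h2 : 1 - Real.exp (-(β * r)) ≤ β * r := by
      have := Real.add_one_le_exp (-(β * r)); linarith
    have h3 : 0 ≤ 1 - Real.exp (-(β * r)) := by
      rw [sub_nonneg, Real.exp_le_one_iff]; nlinarith
    rw [Real.norm_eq_abs, abs_of_nonneg (by positivity)]
    calc r ^ (-s - 1) * (1 - Real.exp (-(β * r))) ≤ r ^ (-s - 1) * (β * r) := by gcongr
      _ = β * (r ^ (-s - 1) * r ^ (1 : ℝ)) := by rw [Real.rpow_one]; ring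
      _ = β * r ^ (-s) := by rw [← Real.rpow_add hr0]; congr 2; ring
  · have h1 : IntegrableOn (fun r : ℝ => r ^ (-s - 1)) (Ioi 1) :=
      integrableOn_Ioi_rpow_of_lt (by linarith) one_pos
    refine h1.mono' (hm _) ?_
    refine (ae_restrict_iff' measurableSet_Ioi).2 (.of_forall fun r hr => ?_)
    have hr0 : 0 < r := one_pos.trans hr
    have h2 : 1 - Real.exp (-(β * r)) ≤ 1 := by
      have := Real.exp_pos (-(β * r)); linarith
    have h3 : 0 ≤ 1 - Real.exp (-(β * r)) := by
      rw [sub_nonneg, Real.exp_le_one_iff]; nlinarith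
    rw [Real.norm_eq_abs, abs_of_nonneg (by positivity)]
    exact mul_le_of_le_one_right (by positivity) h2

/-- Integration by parts, phrased through the antiderivative `F`: its boundary values vanish at 0
because 1 - e^(-βr) ≤ βr and s < 1, and at infinity because s > 0. What remains is the Gamma
integral with parameter 1 - s. -/
theorem integral_rpow_mul_one_sub_exp {s β : ℝ} (hs0 : 0 < s) (hs1 : s < 1) (hβ : 0 < β) :
    ∫ r in Ioi (0 : ℝ), r ^ (-s - 1) * (1 - Real.exp (-(β * r))) =
      β ^ s * Real.Gamma (1 - s) / s := by
  have hi := integrableOn_rpow_mul_one_sub_exp hs0 hs1 hβ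
  have hg : IntegrableOn (fun r : ℝ => r ^ (1 - s - 1) * Real.exp (-(β * r))) (Ioi 0) := by
    have := integrableOn_rpow_mul_exp_neg_mul_rpow (s := -s) (p := 1) (b := β)
      (by linarith) one_pos hβ
    refine this.congr_fun (fun r _ => ?_) measurableSet_Ioi
    simp only [Real.rpow_one]
    congr 2 <;> ring
  have hval := Real.integral_rpow_mul_exp_neg_mul_Ioi (a := 1 - s) (by linarith) hβ
  let F : ℝ → ℝ := fun r => -(r ^ (-s) * (1 - Real.exp (-(β * r)))) / s
  have hd : ∀ r ∈ Ioi (0 : ℝ), HasDerivAt F (r ^ (-s - 1) * (1 - Real.exp (-(β * r))) -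
      β / s * (r ^ (1 - s - 1) * Real.exp (-(β * r)))) r := by
    intro r hr
    have hr : 0 < r := hr
    have h1 : HasDerivAt (fun r : ℝ => r ^ (-s)) (-s * r ^ (-s - 1)) r :=
      Real.hasDerivAt_rpow_const (Or.inl hr.ne')
    have h2 : HasDerivAt (fun r : ℝ => 1 - Real.exp (-(β * r)))
        (β * Real.exp (-(β * r))) r := by
      have := (((hasDerivAt_id r).const_mul β).neg.exp).const_sub 1
      refine this.congr_deriv ?_
      simp only [id, Pi.neg_apply]; ring
    refine ((h1.mul h2).neg.div_const s).congr_deriv ?_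
    have : (1 - s - 1 : ℝ) = -s := by ring
    rw [this]
    field_simp
    ring
  have h0 : Tendsto F (𝓝[>] 0) (𝓝 0) := by
    have hb : Tendsto (fun r : ℝ => β * r ^ (1 - s) / s) (𝓝[>] 0) (𝓝 0) := by
      have : Tendsto (fun r : ℝ => β * r ^ (1 - s) / s) (𝓝 0) (𝓝 (β * 0 ^ (1 - s) / s)) := by
        refine ((Real.continuousAt_rpow_const 0 (1 - s) (Or.inr (by linarith))).tendsto.const_mul
          β).div_const s
      rw [Real.zero_rpow (by linarith)] at this
      simpa using this.mono_left nhdsWithin_le_nhds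
    refine squeeze_zero_norm' ?_ hb
    filter_upwards [self_mem_nhdsWithin] with r hr
    have hr : 0 < r := hr
    have h2 : 1 - Real.exp (-(β * r)) ≤ β * r := by
      have := Real.add_one_le_exp (-(β * r)); linarith
    have h3 : 0 ≤ 1 - Real.exp (-(β * r)) := by
      rw [sub_nonneg, Real.exp_le_one_iff]; nlinarith
    simp only [F]
    rw [Real.norm_eq_abs, abs_div, abs_neg, abs_of_nonneg (by positivity), abs_of_pos hs0]
    refine div_le_div_of_nonneg_right ?_ hs0.le
    calc r ^ (-s) * (1 - Real.exp (-(β * r))) ≤ r ^ (-s) * (β * r) := by gcongr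
      _ = β * (r ^ (-s) * r ^ (1 : ℝ)) := by rw [Real.rpow_one]; ring
      _ = β * r ^ (1 - s) := by rw [← Real.rpow_add hr]; congr 2; ring
  have h1 : Tendsto F atTop (𝓝 0) := by
    have hb : Tendsto (fun r : ℝ => r ^ (-s) / s) atTop (𝓝 0) := by
      simpa using (tendsto_rpow_neg_atTop hs0).div_const s
    refine squeeze_zero_norm' ?_ hb
    filter_upwards [eventually_gt_atTop 0] with r hr
    have h2 : 1 - Real.exp (-(β * r)) ≤ 1 := by
      have := Real.exp_pos (-(β * r)); linarith
    have h3 : 0 ≤ 1 - Real.exp (-(β * r)) := by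
      rw [sub_nonneg, Real.exp_le_one_iff]; nlinarith
    simp only [F]
    rw [Real.norm_eq_abs, abs_div, abs_neg, abs_of_nonneg (by positivity), abs_of_pos hs0]
    gcongr
    exact mul_le_of_le_one_right (by positivity) h2
  -- Redefining `F` at 0 by its limit makes right continuity there the same as `h0`.
  have key := integral_Ioi_of_hasDerivAt_of_tendsto (a := 0) (f := Function.update F 0 0)
    (f' := fun r => r ^ (-s - 1) * (1 - Real.exp (-(β * r))) -
      β / s * (r ^ (1 - s - 1) * Real.exp (-(β * r)))) (m := 0) ?_ ?_ (hi.sub (hg.const_mul _)) ?_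
  · rw [integral_sub hi (hg.const_mul _), integral_const_mul, hval] at key
    simp only [Function.update_self, sub_zero] at key
    rw [sub_eq_zero.1 key, one_div, Real.inv_rpow hβ.le, ← Real.rpow_neg hβ.le,
      show -(1 - s) = s - 1 by ring, Real.rpow_sub_one hβ.ne']
    field_simp
  · rw [← Ioi_insert, continuousWithinAt_insert_self]
    rw [ContinuousWithinAt, Function.update_self]
    refine h0.congr' ?_
    filter_upwards [self_mem_nhdsWithin] with r hr
    rw [Function.update_of_ne (ne_of_gt hr)]
  · intro r hr
    refine (hd r hr).congr_of_eventuallyEq ?_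
    filter_upwards [Ioi_mem_nhds hr] with x hx
    rw [Function.update_of_ne (ne_of_gt hx)]
  · refine h1.congr' ?_
    filter_upwards [eventually_gt_atTop 0] with r hr
    rw [Function.update_of_ne (ne_of_gt hr)]

/-- The substitution r = 1/t gives the form that arises from Gaussian transforms, where t sits in
the denominator of the exponent. -/
theorem integral_rpow_mul_one_sub_exp_neg_div {s β : ℝ} (hs0 : 0 < s) (hs1 : s < 1)
    (hβ : 0 < β) :
    ∫ t in Ioi (0 : ℝ), t ^ (s - 1) * (1 - Real.exp (-(β / t))) =
      β ^ s * Real.Gamma (1 - s) / s := by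
  have h := integral_comp_rpow_Ioi
    (fun r : ℝ => r ^ (-s - 1) * (1 - Real.exp (-(β * r)))) (p := -1) (by norm_num)
  rw [integral_rpow_mul_one_sub_exp hs0 hs1 hβ] at h
  rw [← h]
  refine setIntegral_congr_fun measurableSet_Ioi fun t ht => ?_
  have ht : 0 < t := ht
  simp only [smul_eq_mul, abs_neg, abs_one, one_mul]
  rw [← Real.rpow_mul ht.le, Real.rpow_neg_one t, ← div_eq_mul_inv, ← mul_assoc,
    ← Real.rpow_add ht]
  congr 2
  ring

end OneDim

/-! ### Radial integrals and Gaussian subordination. -/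

section Radial

variable {V : Type*} [NormedAddCommGroup V] [InnerProductSpace ℝ V] [FiniteDimensional ℝ V]
  [MeasurableSpace V] [BorelSpace V]

/-- The common majorant for the singular kernels: in polar coordinates p < d + k gives convergence
at the origin and p > d at infinity. First differences use k = 1, second differences k = 2. -/
theorem integrable_min_one_norm_pow_mul_rpow [Nontrivial V] {k : ℕ} {p : ℝ}
    (hp : (Module.finrank ℝ V : ℝ) < p) (hpk : p < Module.finrank ℝ V + k) :
    Integrable (fun z : V => min 1 (‖z‖ ^ k) * ‖z‖ ^ (-p)) := by
  have hd : 1 ≤ Module.finrank ℝ V := Module.finrank_pos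
  set d := Module.finrank ℝ V
  refine (integrable_fun_norm_addHaar (volume : Measure V)
    (f := fun y : ℝ => min 1 (y ^ k) * y ^ (-p))).2 ?_
  have hcast : ∀ y : ℝ, 0 < y → y ^ (d - 1) = y ^ ((d : ℝ) - 1) := by
    intro y _
    rw [← Real.rpow_natCast, Nat.cast_sub hd, Nat.cast_one]
  rw [← Ioc_union_Ioi_eq_Ioi zero_le_one]
  refine IntegrableOn.union ?_ ?_
  · have h1 : IntegrableOn (fun r : ℝ => r ^ ((d : ℝ) - 1 + k - p)) (Ioc 0 1) :=
      (intervalIntegrable_iff_integrableOn_Ioc_of_le zero_le_one).1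
        (intervalIntegral.intervalIntegrable_rpow' (by linarith))
    refine h1.congr_fun (fun y hy => ?_) measurableSet_Ioc
    have hy0 : 0 < y := hy.1
    simp only [smul_eq_mul]
    rw [min_eq_right (pow_le_one₀ hy0.le hy.2), hcast y hy0, ← Real.rpow_natCast y k,
      ← Real.rpow_add hy0, ← Real.rpow_add hy0]
    congr 1; ring
  · have h1 : IntegrableOn (fun r : ℝ => r ^ ((d : ℝ) - 1 - p)) (Ioi 1) :=
      integrableOn_Ioi_rpow_of_lt (by linarith) one_pos
    refine h1.congr_fun (fun y hy => ?_) measurableSet_Ioi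
    have hy0 : 0 < y := one_pos.trans hy
    simp only [smul_eq_mul]
    rw [min_eq_left (one_le_pow₀ (le_of_lt hy)), hcast y hy0, one_mul, ← Real.rpow_add hy0]
    congr 1

/-- Writing a negative power of the norm as a superposition of Gaussians. -/
theorem Gamma_mul_integral_mul_rpow_norm [Nontrivial V] {h : V → ℂ} {p : ℝ} (hp : 0 < p)
    (hm : AEStronglyMeasurable h)
    (hi : Integrable (fun z => h z * ((‖z‖ ^ (-(2 * p)) : ℝ) : ℂ))) :
    (Real.Gamma p : ℂ) * ∫ z, h z * ((‖z‖ ^ (-(2 * p)) : ℝ) : ℂ) =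
      ∫ t in Ioi (0 : ℝ), ((t ^ (p - 1) : ℝ) : ℂ) *
        ∫ z, h z * (Real.exp (-(t * ‖z‖ ^ 2)) : ℂ) := by
  -- At z = 0 the t-integral diverges; in a nontrivial space the origin is a null set.
  have hne : ∀ᵐ z : V, z ≠ 0 := by
    simp [ae_iff, measure_singleton]
  have hI : ∀ z : V, z ≠ 0 → ∫ t in Ioi (0 : ℝ), t ^ (p - 1) * Real.exp (-(‖z‖ ^ 2 * t)) =
      ‖z‖ ^ (-(2 * p)) * Real.Gamma p := by
    intro z hz
    have hz : 0 < ‖z‖ := norm_pos_iff.2 hz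
    rw [Real.integral_rpow_mul_exp_neg_mul_Ioi hp (by positivity), one_div,
      Real.inv_rpow (by positivity), ← Real.rpow_natCast, ← Real.rpow_mul hz.le,
      ← Real.rpow_neg hz.le]
    push_cast; rfl
  have hIi : ∀ z : V, z ≠ 0 →
      IntegrableOn (fun t : ℝ => t ^ (p - 1) * Real.exp (-(‖z‖ ^ 2 * t))) (Ioi 0) := by
    intro z hz
    have hz : 0 < ‖z‖ := norm_pos_iff.2 hz
    have := integrableOn_rpow_mul_exp_neg_mul_rpow (s := p - 1) (p := 1) (b := ‖z‖ ^ 2)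
      (by linarith) one_pos (by positivity)
    refine this.congr_fun (fun r _ => ?_) measurableSet_Ioi
    simp only [Real.rpow_one]
    congr 2; ring
  let K : V → ℝ → ℂ := fun z t => h z * ((t ^ (p - 1) * Real.exp (-(‖z‖ ^ 2 * t)) : ℝ) : ℂ)
  -- Integrating |K| in t gives Γ(p) |h(z)| |z|^(-2p), so joint integrability reduces to `hi`.
  have hK : Integrable (Function.uncurry K)
      ((volume : Measure V).prod (volume.restrict (Ioi (0 : ℝ)))) := by
    rw [integrable_prod_iff]
    · constructor
      · filter_upwards [hne] with z hz
        exact Integrable.const_mul ((hIi z hz).ofReal (𝕜 := ℂ)) (h z)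
      · refine (hi.norm.mul_const (Real.Gamma p)).congr ?_
        filter_upwards [hne] with z hz
        have : ∫ t in Ioi (0 : ℝ), ‖Function.uncurry K (z, t)‖ =
            ∫ t in Ioi (0 : ℝ), ‖h z‖ * (t ^ (p - 1) * Real.exp (-(‖z‖ ^ 2 * t))) := by
          refine setIntegral_congr_fun measurableSet_Ioi fun t ht => ?_
          have ht : 0 < t := ht
          simp only [Function.uncurry, K, norm_mul, Complex.norm_real, Real.norm_eq_abs]
          rw [abs_of_nonneg (by positivity), abs_of_nonneg (by positivity)]
        rw [this, integral_const_mul, hI z hz, norm_mul, Complex.norm_real, Real.norm_eq_abs,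
          abs_of_nonneg (by positivity), mul_assoc]
    · refine (hm.comp_fst).mul (Measurable.aestronglyMeasurable ?_)
      fun_prop
  have hswap := integral_integral_swap hK
  have hl : ∫ z, ∫ t in Ioi (0 : ℝ), K z t =
      (Real.Gamma p : ℂ) * ∫ z, h z * ((‖z‖ ^ (-(2 * p)) : ℝ) : ℂ) := by
    rw [← integral_const_mul]
    refine integral_congr_ae ?_
    filter_upwards [hne] with z hz
    simp only [K]
    rw [integral_const_mul, integral_complex_ofReal, hI z hz]
    push_cast; ring
  rw [← hl, hswap]
  refine setIntegral_congr_fun measurableSet_Ioi fun t _ => ?_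
  rw [← integral_const_mul]
  refine integral_congr_ae (.of_forall fun z => ?_)
  simp only [K]
  rw [mul_comm (‖z‖ ^ 2) t]
  push_cast; ring

end Radial

/-! ### Plane waves and bounds for their differences. -/

section Waves

variable {V : Type*} [NormedAddCommGroup V] [InnerProductSpace ℝ V]

/-- The plane wave `x ↦ exp (2 π i ⟨x, ξ⟩)`. -/
noncomputable def planeWave (ξ x : V) : ℂ :=
  Complex.exp ((2 * π * inner ℝ x ξ : ℝ) * Complex.I)

theorem norm_planeWave (ξ x : V) : ‖planeWave ξ x‖ = 1 :=
  Complex.norm_exp_ofReal_mul_I _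

theorem planeWave_sub (ξ x y : V) : planeWave ξ (x - y) = planeWave ξ x * planeWave ξ (-y) := by
  rw [planeWave, planeWave, planeWave, ← Complex.exp_add, ← add_mul, ← Complex.ofReal_add,
    ← mul_add, ← inner_add_left, sub_eq_add_neg]

@[simp] theorem planeWave_zero_left (x : V) : planeWave 0 x = 1 := by simp [planeWave]

/-- The trivial bound 2 and the Lipschitz bound 2π|z||ξ| are merged. The growth in ξ is linear, so a
first difference costs one moment of the spectrum. -/
theorem norm_one_sub_planeWave_le (ξ z : V) :
    ‖1 - planeWave ξ z‖ ≤ 2 * π * (1 + ‖ξ‖) * min 1 ‖z‖ := by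
  have hπ := Real.pi_gt_three
  rcases le_total 1 ‖z‖ with h | h
  · rw [min_eq_left h]
    calc ‖1 - planeWave ξ z‖ ≤ ‖(1 : ℂ)‖ + ‖planeWave ξ z‖ := norm_sub_le _ _
      _ = 2 := by rw [norm_planeWave, norm_one]; norm_num
      _ ≤ _ := by nlinarith [norm_nonneg ξ]
  · rw [min_eq_right h, norm_sub_rev, planeWave, mul_comm _ Complex.I]
    refine Real.norm_exp_I_mul_ofReal_sub_one_le.trans ?_
    rw [norm_mul, Real.norm_of_nonneg (by positivity), Real.norm_eq_abs]
    have h1 := abs_real_inner_le_norm z ξ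
    have h2 : ‖z‖ * ‖ξ‖ ≤ (1 + ‖ξ‖) * ‖z‖ := by nlinarith [norm_nonneg z]
    calc 2 * π * |inner ℝ z ξ| ≤ 2 * π * ((1 + ‖ξ‖) * ‖z‖) := by gcongr; exact h1.trans h2
      _ = _ := by ring

theorem one_sub_cos_inner_nonneg (ξ z : V) : 0 ≤ 1 - Real.cos (2 * π * inner ℝ z ξ) :=
  sub_nonneg.2 (Real.cos_le_one _)

/-- Here the gain at the origin is quadratic, at the cost of two moments in ξ. -/
theorem one_sub_cos_inner_le (ξ z : V) :
    1 - Real.cos (2 * π * inner ℝ z ξ) ≤ 2 * π ^ 2 * (1 + ‖ξ‖) ^ 2 * min 1 (‖z‖ ^ 2) := by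
  have hπ := Real.pi_gt_three
  rcases le_total 1 (‖z‖ ^ 2) with h | h
  · rw [min_eq_left h]
    have := Real.neg_one_le_cos (2 * π * inner ℝ z ξ)
    have h1 : 1 ≤ (1 + ‖ξ‖) ^ 2 := by nlinarith [norm_nonneg ξ]
    have h2 : 1 ≤ π ^ 2 := by nlinarith
    nlinarith
  · rw [min_eq_right h]
    have h0 := Real.one_sub_sq_div_two_le_cos (x := 2 * π * inner ℝ z ξ)
    have h1 : (inner ℝ z ξ) ^ 2 ≤ (‖z‖ * ‖ξ‖) ^ 2 :=
      sq_le_sq' (by linarith [neg_abs_le (inner ℝ z ξ), abs_real_inner_le_norm z ξ])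
        (real_inner_le_norm z ξ)
    have h2 : (‖z‖ * ‖ξ‖) ^ 2 ≤ (1 + ‖ξ‖) ^ 2 * ‖z‖ ^ 2 := by
      rw [mul_pow, mul_comm]
      gcongr
      linarith
    calc 1 - Real.cos (2 * π * inner ℝ z ξ) ≤ 2 * π ^ 2 * (inner ℝ z ξ) ^ 2 := by
          nlinarith
      _ ≤ 2 * π ^ 2 * ((1 + ‖ξ‖) ^ 2 * ‖z‖ ^ 2) := by gcongr; exact h1.trans h2
      _ = _ := by ring

theorem ofReal_cos_inner (ξ z : V) :
    ((Real.cos (2 * π * inner ℝ z ξ) : ℝ) : ℂ) = (planeWave ξ z + planeWave ξ (-z)) / 2 := by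
  rw [Complex.ofReal_cos, Complex.cos, planeWave, planeWave, inner_neg_left]
  push_cast
  ring_nf

theorem norm_one_sub_planeWave_mul_inner_mul_rpow_le (ξ z a : V) (p : ℝ) :
    ‖(1 - planeWave ξ z) * ((inner ℝ z a * ‖z‖ ^ (-(p + 1)) : ℝ) : ℂ)‖ ≤
      2 * π * (1 + ‖ξ‖) * ‖a‖ * (min 1 (‖z‖ ^ 1) * ‖z‖ ^ (-p)) := by
  rcases eq_or_ne z 0 with rfl | hz
  · simp
  have hz : 0 < ‖z‖ := norm_pos_iff.2 hz
  rw [norm_mul, Complex.norm_real, norm_mul, Real.norm_eq_abs, pow_one,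
    Real.norm_of_nonneg (by positivity : 0 ≤ ‖z‖ ^ (-(p + 1)))]
  have h1 := abs_real_inner_le_norm z a
  calc _ ≤ 2 * π * (1 + ‖ξ‖) * min 1 ‖z‖ * (‖z‖ * ‖a‖ * ‖z‖ ^ (-(p + 1))) := by
        gcongr
        exact norm_one_sub_planeWave_le ξ z
    _ = 2 * π * (1 + ‖ξ‖) * ‖a‖ * (min 1 ‖z‖ * (‖z‖ ^ (1 : ℝ) * ‖z‖ ^ (-(p + 1)))) := by
        rw [Real.rpow_one]; ring
    _ = _ := by rw [← Real.rpow_add hz]; congr 3; ring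

end Waves

/-! ### Gaussian integrals against plane waves. -/

section Gaussian

variable {V : Type*} [NormedAddCommGroup V] [InnerProductSpace ℝ V] [FiniteDimensional ℝ V]
  [MeasurableSpace V] [BorelSpace V]

theorem integrable_exp_neg_mul_sq_norm {t : ℝ} (ht : 0 < t) :
    Integrable fun z : V => Real.exp (-(t * ‖z‖ ^ 2)) := by
  have := (GaussianFourier.integrable_cexp_neg_mul_sq_norm_add (V := V) (b := (t : ℂ))
    (by simpa using ht) 0 0).norm
  refine this.congr (.of_forall fun z => ?_)
  simp only [Complex.norm_exp]
  congr 1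
  simp [← Complex.ofReal_pow]

theorem integrable_norm_mul_exp_neg_mul_sq_norm {t : ℝ} (ht : 0 < t) :
    Integrable fun z : V => ‖z‖ * Real.exp (-(t * ‖z‖ ^ 2)) := by
  refine Integrable.mono' ((integrable_exp_neg_mul_sq_norm (V := V) ht).add
    ((integrable_exp_neg_mul_sq_norm (V := V) (half_pos ht)).const_mul (2 / t)))
    (Continuous.aestronglyMeasurable (by fun_prop)) (.of_forall fun z => ?_)
  rw [Real.norm_of_nonneg (by positivity)]
  simp only [Pi.add_apply]
  have h1 : ‖z‖ ≤ 1 + ‖z‖ ^ 2 := by nlinarith [sq_nonneg (‖z‖ - 1), norm_nonneg z]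
  -- The quadratic factor is absorbed by half of the Gaussian's decay rate.
  have h2 : ‖z‖ ^ 2 ≤ 2 / t * Real.exp (t / 2 * ‖z‖ ^ 2) := by
    have := Real.add_one_le_exp (t / 2 * ‖z‖ ^ 2)
    calc ‖z‖ ^ 2 = 2 / t * (t / 2 * ‖z‖ ^ 2) := by field_simp
      _ ≤ _ := by gcongr; linarith
  calc ‖z‖ * Real.exp (-(t * ‖z‖ ^ 2))
      ≤ (1 + 2 / t * Real.exp (t / 2 * ‖z‖ ^ 2)) * Real.exp (-(t * ‖z‖ ^ 2)) := by
        gcongr; linarith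
    _ = Real.exp (-(t * ‖z‖ ^ 2)) +
        2 / t * (Real.exp (t / 2 * ‖z‖ ^ 2) * Real.exp (-(t * ‖z‖ ^ 2))) := by ring
    _ = _ := by rw [← Real.exp_add]; congr 3; ring

theorem integrable_mul_exp_neg_mul_sq_norm_of_norm_le {t C : ℝ} (ht : 0 < t) {h : V → ℂ}
    (hm : AEStronglyMeasurable h) (hC : ∀ z, ‖h z‖ ≤ C) :
    Integrable fun z : V => h z * (Real.exp (-(t * ‖z‖ ^ 2)) : ℂ) :=
  ((integrable_exp_neg_mul_sq_norm ht).ofReal (𝕜 := ℂ)).bdd_mul hm (.of_forall hC)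

theorem integrable_mul_inner_mul_exp_neg_mul_sq_norm {t C : ℝ} (ht : 0 < t) {h : V → ℂ}
    (hm : AEStronglyMeasurable h) (hC : ∀ z, ‖h z‖ ≤ C) (a : V) :
    Integrable fun z : V => h z * ((inner ℝ z a : ℝ) : ℂ) * (Real.exp (-(t * ‖z‖ ^ 2)) : ℂ) := by
  have h1 : Integrable fun z : V => ((inner ℝ z a * Real.exp (-(t * ‖z‖ ^ 2)) : ℝ) : ℂ) := by
    suffices h2 : Integrable fun z : V => inner ℝ z a * Real.exp (-(t * ‖z‖ ^ 2)) from
      h2.ofReal (𝕜 := ℂ)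
    refine Integrable.mono' ((integrable_norm_mul_exp_neg_mul_sq_norm (V := V) ht).const_mul ‖a‖)
      (Continuous.aestronglyMeasurable (by fun_prop)) (.of_forall fun z => ?_)
    rw [norm_mul, Real.norm_eq_abs, Real.norm_of_nonneg (Real.exp_pos _).le, ← mul_assoc,
      mul_comm ‖a‖]
    gcongr
    exact abs_real_inner_le_norm z a
  refine (h1.bdd_mul hm (.of_forall hC)).congr (.of_forall fun z => ?_)
  simp only
  push_cast; ring

theorem integral_planeWave_mul_gaussian {t : ℝ} (ht : 0 < t) (ξ : V) :
    ∫ z, planeWave ξ z * (Real.exp (-(t * ‖z‖ ^ 2)) : ℂ) =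
      (((π / t) ^ ((Module.finrank ℝ V : ℝ) / 2) *
        Real.exp (-(π ^ 2 * ‖ξ‖ ^ 2 / t)) : ℝ) : ℂ) := by
  have h := GaussianFourier.integral_cexp_neg_mul_sq_norm_add (V := V) (b := (t : ℂ))
    (by simpa using ht) (2 * π * Complex.I) ξ
  rw [Complex.ofReal_mul, Complex.ofReal_cpow (by positivity)]
  push_cast
  convert h using 1
  · refine integral_congr_ae (.of_forall fun z => ?_)
    simp only [planeWave]
    rw [← Complex.exp_add, real_inner_comm]
    push_cast
    ring_nf
  · congr 2
    field_simp
    rw [Complex.I_sq]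
    ring

/-- The factor ⟨z,a⟩ e^(-t|z|²) is -1/(2t) times the derivative of the Gaussian along a. Integration
by parts moves this derivative to the plane wave, where it produces 2πi⟨a,ξ⟩. -/
theorem integral_planeWave_mul_inner_mul_gaussian {t : ℝ} (ht : 0 < t) (ξ a : V) :
    ∫ z, planeWave ξ z * ((inner ℝ z a : ℝ) : ℂ) * (Real.exp (-(t * ‖z‖ ^ 2)) : ℂ) =
      Complex.I * ((π * inner ℝ a ξ / t * ((π / t) ^ ((Module.finrank ℝ V : ℝ) / 2) *
        Real.exp (-(π ^ 2 * ‖ξ‖ ^ 2 / t))) : ℝ) : ℂ) := by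
  let f : V → ℂ := planeWave ξ
  let g : V → ℂ := fun z => (Real.exp (-(t * ‖z‖ ^ 2)) : ℂ)
  have hfm : AEStronglyMeasurable f :=
    Continuous.aestronglyMeasurable (by unfold f planeWave; fun_prop)
  have hf : ∀ z, HasFDerivAt f ((2 * π * Complex.I * f z) •
      (Complex.ofRealCLM.comp ((innerSL ℝ ξ : V →L[ℝ] ℝ)))) z := by
    intro z
    have h1 : HasFDerivAt (fun z : V => ((inner ℝ ξ z : ℝ) : ℂ))
        (Complex.ofRealCLM.comp (innerSL ℝ ξ : V →L[ℝ] ℝ)) z :=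
      (Complex.ofRealCLM.comp (innerSL ℝ ξ : V →L[ℝ] ℝ)).hasFDerivAt
    have h2 := (h1.const_mul (2 * π * Complex.I)).cexp
    have h3 : f = fun z : V => Complex.exp (2 * π * Complex.I * ((inner ℝ ξ z : ℝ) : ℂ)) := by
      funext z
      simp only [f, planeWave, real_inner_comm z ξ]
      push_cast; ring_nf
    rw [h3]
    refine h2.congr_fderiv ?_
    ext w; simp; ring
  have hg : ∀ z, HasFDerivAt g ((-2 * t * g z) •
      (Complex.ofRealCLM.comp (innerSL ℝ z : V →L[ℝ] ℝ))) z := by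
    intro z
    have h1 : HasFDerivAt (fun z : V => Real.exp (-(t * ‖z‖ ^ 2)))
        (Real.exp (-(t * ‖z‖ ^ 2)) • (-(t • ((2 : ℕ) • (innerSL ℝ z : V →L[ℝ] ℝ))))) z :=
      (((hasStrictFDerivAt_norm_sq z).hasFDerivAt.const_mul t).fun_neg).exp
    have h2 := Complex.ofRealCLM.hasFDerivAt.comp z h1
    refine h2.congr_fderiv ?_
    ext w; simp [g]; ring
  have hf' : ∀ z, fderiv ℝ f z a = 2 * π * Complex.I * (inner ℝ a ξ : ℝ) * f z := by
    intro z; rw [(hf z).fderiv]; simp [real_inner_comm a ξ]; ring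
  have hg' : ∀ z, fderiv ℝ g z a = -2 * t * ((inner ℝ z a : ℝ) * g z) := by
    intro z; rw [(hg z).fderiv]; simp; ring
  have hfg : Integrable fun z => f z * g z :=
    integrable_mul_exp_neg_mul_sq_norm_of_norm_le ht hfm (fun z => (norm_planeWave ξ z).le)
  have hfig : Integrable fun z => f z * ((inner ℝ z a : ℝ) : ℂ) * g z :=
    integrable_mul_inner_mul_exp_neg_mul_sq_norm ht hfm (fun z => (norm_planeWave ξ z).le) a
  have hibp := integral_mul_fderiv_eq_neg_fderiv_mul_of_integrable (μ := (volume : Measure V))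
    (f := f) (g := g) (v := a) ?_ ?_ hfg (fun z _ => (hf z).differentiableAt)
    (fun z _ => (hg z).differentiableAt)
  · simp only [hf', hg'] at hibp
    have e1 : ∀ z, f z * (-2 * t * ((inner ℝ z a : ℝ) * g z)) =
        (-2 * t) * (f z * ((inner ℝ z a : ℝ) : ℂ) * g z) := fun z => by ring
    have e2 : ∀ z, 2 * π * Complex.I * (inner ℝ a ξ : ℝ) * f z * g z =
        (2 * π * Complex.I * (inner ℝ a ξ : ℝ)) * (f z * g z) := fun z => by ring
    simp only [e1, e2, integral_const_mul] at hibp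
    have h0 := integral_planeWave_mul_gaussian ht ξ
    change ∫ z, f z * g z = _ at h0
    change ∫ z, f z * ((inner ℝ z a : ℝ) : ℂ) * g z = _
    rw [h0] at hibp
    have ht' : (t : ℂ) ≠ 0 := by exact_mod_cast ht.ne'
    have : ∫ z, f z * ((inner ℝ z a : ℝ) : ℂ) * g z =
        (-2 * t * ∫ z, f z * ((inner ℝ z a : ℝ) : ℂ) * g z) / (-2 * t) := by field_simp
    rw [this, hibp]
    push_cast
    field_simp
  · simp only [hf']
    refine (hfg.const_mul (2 * π * Complex.I * (inner ℝ a ξ : ℝ))).congr (.of_forall fun z => ?_)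
    simp only; ring
  · simp only [hg']
    refine (hfig.const_mul (-2 * t : ℂ)).congr (.of_forall fun z => ?_)
    simp only; ring

/-- The constant 1 is the plane wave of frequency 0, which contributes nothing since the integrand
is then odd. It is kept because the difference is what is integrable against the singular kernel. -/
theorem integral_one_sub_planeWave_mul_inner_mul_gaussian {t : ℝ} (ht : 0 < t) (ξ a : V) :
    ∫ z, (1 - planeWave ξ z) * ((inner ℝ z a : ℝ) : ℂ) * (Real.exp (-(t * ‖z‖ ^ 2)) : ℂ) =
      -Complex.I * ((π * inner ℝ a ξ / t * ((π / t) ^ ((Module.finrank ℝ V : ℝ) / 2) *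
        Real.exp (-(π ^ 2 * ‖ξ‖ ^ 2 / t))) : ℝ) : ℂ) := by
  have h1 := integral_planeWave_mul_inner_mul_gaussian ht ξ a
  have h0 := integral_planeWave_mul_inner_mul_gaussian ht 0 a
  have hi : ∀ ξ : V, Integrable fun z : V =>
      planeWave ξ z * ((inner ℝ z a : ℝ) : ℂ) * (Real.exp (-(t * ‖z‖ ^ 2)) : ℂ) := fun ξ =>
    integrable_mul_inner_mul_exp_neg_mul_sq_norm ht
      (Continuous.aestronglyMeasurable (by unfold planeWave; fun_prop))
      (fun z => (norm_planeWave ξ z).le) a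
  have e : ∀ z : V, (1 - planeWave ξ z) * ((inner ℝ z a : ℝ) : ℂ) *
      (Real.exp (-(t * ‖z‖ ^ 2)) : ℂ) =
      planeWave 0 z * ((inner ℝ z a : ℝ) : ℂ) * (Real.exp (-(t * ‖z‖ ^ 2)) : ℂ) -
      planeWave ξ z * ((inner ℝ z a : ℝ) : ℂ) * (Real.exp (-(t * ‖z‖ ^ 2)) : ℂ) := by
    intro z; rw [planeWave_zero_left]; ring
  simp only [e]
  rw [integral_sub (hi 0) (hi ξ), h0, h1]
  simp

theorem integral_one_sub_cos_mul_gaussian {t : ℝ} (ht : 0 < t) (ξ : V) :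
    ∫ z, ((1 - Real.cos (2 * π * inner ℝ z ξ) : ℝ) : ℂ) * (Real.exp (-(t * ‖z‖ ^ 2)) : ℂ) =
      (((π / t) ^ ((Module.finrank ℝ V : ℝ) / 2) *
        (1 - Real.exp (-(π ^ 2 * ‖ξ‖ ^ 2 / t))) : ℝ) : ℂ) := by
  have hi : ∀ ξ : V, Integrable fun z : V =>
      planeWave ξ z * (Real.exp (-(t * ‖z‖ ^ 2)) : ℂ) := fun ξ =>
    integrable_mul_exp_neg_mul_sq_norm_of_norm_le ht
      (Continuous.aestronglyMeasurable (by unfold planeWave; fun_prop))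
      (fun z => (norm_planeWave ξ z).le)
  have e : ∀ z : V, ((1 - Real.cos (2 * π * inner ℝ z ξ) : ℝ) : ℂ) *
      (Real.exp (-(t * ‖z‖ ^ 2)) : ℂ) =
      planeWave 0 z * (Real.exp (-(t * ‖z‖ ^ 2)) : ℂ) -
      (planeWave ξ z * (Real.exp (-(t * ‖z‖ ^ 2)) : ℂ) +
       planeWave (-ξ) z * (Real.exp (-(t * ‖z‖ ^ 2)) : ℂ)) / 2 := by
    intro z
    rw [planeWave_zero_left, Complex.ofReal_sub, ofReal_cos_inner,
      show planeWave ξ (-z) = planeWave (-ξ) z by simp [planeWave]]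
    push_cast; ring
  simp only [e]
  rw [integral_sub (hi 0) (((hi ξ).fun_add (hi (-ξ))).div_const 2), integral_div,
    integral_add (hi ξ) (hi (-ξ))]
  simp only [integral_planeWave_mul_gaussian ht]
  simp
  ring

end Gaussian

/-! ### Fourier multipliers of the singular kernels. -/

section Multipliers

variable {V : Type*} [NormedAddCommGroup V] [InnerProductSpace ℝ V] [FiniteDimensional ℝ V]
  [MeasurableSpace V] [BorelSpace V] [Nontrivial V]

theorem integrable_one_sub_planeWave_mul_inner_mul_rpow {s : ℝ} (hs0 : 0 < s) (hs1 : s < 1)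
    (ξ a : V) :
    Integrable fun z => (1 - planeWave ξ z) *
      ((inner ℝ z a * ‖z‖ ^ (-((Module.finrank ℝ V : ℝ) + s + 1)) : ℝ) : ℂ) := by
  refine Integrable.mono' ((integrable_min_one_norm_pow_mul_rpow (V := V) (k := 1)
    (p := Module.finrank ℝ V + s) (by linarith) (by push_cast; linarith)).const_mul
      (2 * π * (1 + ‖ξ‖) * ‖a‖)) ?_
    (.of_forall fun z => norm_one_sub_planeWave_mul_inner_mul_rpow_le ξ z a _)
  refine Measurable.aestronglyMeasurable ?_
  unfold planeWave
  fun_prop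

/-- Subordination with p = (d+s+1)/2 replaces the power by Gaussians. After the Gaussian integral in
z, the t-integral is an inverse-variable Gamma integral with parameter (1-s)/2. -/
theorem integral_one_sub_planeWave_mul_inner_mul_rpow {s : ℝ} (hs0 : 0 < s) (hs1 : s < 1)
    (ξ a : V) :
    (Real.Gamma (((Module.finrank ℝ V : ℝ) + s + 1) / 2) : ℂ) * ∫ z, (1 - planeWave ξ z) *
      ((inner ℝ z a * ‖z‖ ^ (-((Module.finrank ℝ V : ℝ) + s + 1)) : ℝ) : ℂ) =
    -Complex.I * ((inner ℝ a ξ * (π ^ ((Module.finrank ℝ V : ℝ) / 2) * π ^ s *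
      ‖ξ‖ ^ (s - 1) * Real.Gamma ((1 - s) / 2)) : ℝ) : ℂ) := by
  rcases eq_or_ne ξ 0 with rfl | hξ
  · simp
  have hξ : 0 < ‖ξ‖ := norm_pos_iff.2 hξ
  set d : ℝ := (Module.finrank ℝ V : ℝ) with hd
  have hd0 : 0 ≤ d := by positivity
  have hi := integrable_one_sub_planeWave_mul_inner_mul_rpow hs0 hs1 ξ a
  rw [← hd] at hi
  have e : ∀ z : V, (1 - planeWave ξ z) * ((inner ℝ z a * ‖z‖ ^ (-(d + s + 1)) : ℝ) : ℂ) =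
      ((1 - planeWave ξ z) * ((inner ℝ z a : ℝ) : ℂ)) *
        ((‖z‖ ^ (-(2 * ((d + s + 1) / 2))) : ℝ) : ℂ) := by
    intro z
    rw [mul_div_cancel₀ _ (two_ne_zero' ℝ)]
    push_cast; ring
  simp only [e] at hi ⊢
  rw [Gamma_mul_integral_mul_rpow_norm (by positivity)
    (Continuous.aestronglyMeasurable (by unfold planeWave; fun_prop)) hi]
  have h1 := integral_rpow_mul_exp_neg_div (a := (1 - s) / 2) (β := π ^ 2 * ‖ξ‖ ^ 2)
    (by linarith) (by positivity)
  calc _ = ∫ t in Ioi (0 : ℝ), (-Complex.I * ((inner ℝ a ξ * (π * π ^ (d / 2)) : ℝ) : ℂ)) *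
        ((t ^ (-((1 - s) / 2) - 1) * Real.exp (-(π ^ 2 * ‖ξ‖ ^ 2 / t)) : ℝ) : ℂ) := by
        refine setIntegral_congr_fun measurableSet_Ioi fun t ht => ?_
        have ht : 0 < t := ht
        rw [integral_one_sub_planeWave_mul_inner_mul_gaussian ht, Real.div_rpow pi_pos.le ht.le]
        -- The powers of t come from subordination, from the factor 1/t of the first-moment formula,
        -- and from (π/t)^(d/2).
        have : t ^ (-((1 - s) / 2) - 1) = t ^ ((d + s + 1) / 2 - 1) / t / t ^ (d / 2) := by
          rw [← Real.rpow_sub_one ht.ne', ← Real.rpow_sub ht]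
          congr 1; ring
        rw [← hd, this]
        push_cast
        field_simp
    _ = _ := by
        rw [integral_const_mul, integral_complex_ofReal, h1, mul_assoc, ← Complex.ofReal_mul]
        congr 2
        have h2 : (π ^ 2 * ‖ξ‖ ^ 2) ^ (-((1 - s) / 2)) = π ^ (s - 1) * ‖ξ‖ ^ (s - 1) := by
          rw [← mul_pow, ← Real.rpow_natCast, ← Real.rpow_mul (by positivity),
            Real.mul_rpow pi_pos.le hξ.le]
          congr 2 <;> (push_cast; ring)
        rw [h2, Real.rpow_sub_one pi_pos.ne']
        field_simp

theorem integrable_one_sub_cos_mul_rpow {s : ℝ} (hs0 : 0 < s) (hs1 : s < 1) (ξ : V) :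
    Integrable fun z => (1 - Real.cos (2 * π * inner ℝ z ξ)) *
      ‖z‖ ^ (-((Module.finrank ℝ V : ℝ) + 2 * s)) := by
  refine Integrable.mono' ((integrable_min_one_norm_pow_mul_rpow (V := V) (k := 2)
    (p := Module.finrank ℝ V + 2 * s) (by linarith) (by push_cast; linarith)).const_mul
      (2 * π ^ 2 * (1 + ‖ξ‖) ^ 2)) (Measurable.aestronglyMeasurable (by fun_prop))
    (.of_forall fun z => ?_)
  have := one_sub_cos_inner_nonneg ξ z
  rw [Real.norm_of_nonneg (by positivity), ← mul_assoc]
  gcongr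
  exact one_sub_cos_inner_le ξ z

/-- The same subordination with p = (d+2s)/2; the powers of t collapse to t^(s-1), so the dimension
drops out of the remaining integral. -/
theorem integral_one_sub_cos_mul_rpow {s : ℝ} (hs0 : 0 < s) (hs1 : s < 1) (ξ : V) :
    Real.Gamma (((Module.finrank ℝ V : ℝ) + 2 * s) / 2) * ∫ z,
      (1 - Real.cos (2 * π * inner ℝ z ξ)) * ‖z‖ ^ (-((Module.finrank ℝ V : ℝ) + 2 * s)) =
    π ^ ((Module.finrank ℝ V : ℝ) / 2) * (π * ‖ξ‖) ^ (2 * s) * Real.Gamma (1 - s) / s := by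
  rcases eq_or_ne ξ 0 with rfl | hξ
  · simp [Real.zero_rpow (by linarith : 2 * s ≠ 0)]
  have hξ : 0 < ‖ξ‖ := norm_pos_iff.2 hξ
  set d : ℝ := (Module.finrank ℝ V : ℝ) with hd
  have hd0 : 0 ≤ d := by positivity
  have hi := (integrable_one_sub_cos_mul_rpow hs0 hs1 ξ).ofReal (𝕜 := ℂ)
  rw [← hd] at hi
  have e : ∀ z : V, (((1 - Real.cos (2 * π * inner ℝ z ξ)) * ‖z‖ ^ (-(d + 2 * s)) : ℝ) : ℂ) =
      ((1 - Real.cos (2 * π * inner ℝ z ξ) : ℝ) : ℂ) *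
        ((‖z‖ ^ (-(2 * ((d + 2 * s) / 2))) : ℝ) : ℂ) := by
    intro z
    rw [mul_div_cancel₀ _ (two_ne_zero' ℝ), Complex.ofReal_mul]
  rw [← Complex.ofReal_inj, Complex.ofReal_mul, ← integral_complex_ofReal]
  change Integrable (fun z : V =>
    (((1 - Real.cos (2 * π * inner ℝ z ξ)) * ‖z‖ ^ (-(d + 2 * s)) : ℝ) : ℂ)) at hi
  simp only [e] at hi ⊢
  rw [Gamma_mul_integral_mul_rpow_norm (by positivity)
    (Continuous.aestronglyMeasurable (by fun_prop)) hi]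
  have h1 := integral_rpow_mul_one_sub_exp_neg_div (β := π ^ 2 * ‖ξ‖ ^ 2) hs0 hs1 (by positivity)
  calc _ = ∫ t in Ioi (0 : ℝ), ((π ^ (d / 2) *
        (t ^ (s - 1) * (1 - Real.exp (-(π ^ 2 * ‖ξ‖ ^ 2 / t)))) : ℝ) : ℂ) := by
        refine setIntegral_congr_fun measurableSet_Ioi fun t ht => ?_
        have ht : 0 < t := ht
        rw [integral_one_sub_cos_mul_gaussian ht, Real.div_rpow pi_pos.le ht.le,
          ← Complex.ofReal_mul, ← hd]
        have : t ^ (s - 1) = t ^ ((d + 2 * s) / 2 - 1) / t ^ (d / 2) := by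
          rw [← Real.rpow_sub ht]
          congr 1; ring
        rw [this]
        congr 1
        field_simp
    _ = _ := by
        rw [integral_complex_ofReal, integral_const_mul, h1]
        congr 1
        have h2 : (π ^ 2 * ‖ξ‖ ^ 2) ^ s = (π * ‖ξ‖) ^ (2 * s) := by
          rw [← mul_pow, ← Real.rpow_natCast, ← Real.rpow_mul (by positivity)]
          norm_num
        rw [h2]
        ring

end Multipliers

/-! ### Symbols of the fractional operators, with their constants. -/

section Symbols

variable {n : ℕ}

/-- The scalar kernel of the fractional derivative in the direction `a`. -/
noncomputable def dirKernel (s : ℝ) (a z : EuclideanSpace ℝ (Fin n)) : ℝ :=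
  inner ℝ z a * ‖z‖ ^ (-((n : ℝ) + s + 1))

/-- The Fourier symbol of the fractional derivative in the direction `a`. -/
noncomputable def dirSymbol (s : ℝ) (a ξ : EuclideanSpace ℝ (Fin n)) : ℂ :=
  Complex.I * (((2 * π) ^ s * ‖ξ‖ ^ (s - 1) * inner ℝ a ξ : ℝ) : ℂ)

theorem measurable_dirKernel (s : ℝ) (a : EuclideanSpace ℝ (Fin n)) :
    Measurable (dirKernel s a) := by
  unfold dirKernel; fun_prop

theorem measurable_dirSymbol (s : ℝ) (a : EuclideanSpace ℝ (Fin n)) :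
    Measurable (dirSymbol s a) := by
  unfold dirSymbol; fun_prop

/-- The functional equation Γ(x+1) = xΓ(x) at x = (n-1+s)/2 absorbs the numerator n-1+s and exposes
the Gamma factor that the multiplier integral cancels. -/
theorem rieszConst_eq {s : ℝ} (hn : 1 ≤ n) (hs0 : 0 < s) (hs1 : s < 1) :
    rieszConst n s = 2 ^ s * Real.Gamma (((n : ℝ) + s + 1) / 2) /
      (π ^ ((n : ℝ) / 2) * Real.Gamma ((1 - s) / 2)) := by
  have hn' : (1 : ℝ) ≤ n := by exact_mod_cast hn
  have hg : Real.Gamma (((n : ℝ) + s + 1) / 2) =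
      ((n : ℝ) - 1 + s) / 2 * Real.Gamma (((n : ℝ) - (1 - s)) / 2) := by
    rw [show ((n : ℝ) + s + 1) / 2 = ((n : ℝ) - 1 + s) / 2 + 1 by ring,
      Real.Gamma_add_one (by linarith)]
    congr 2; ring
  have h1 : 0 < Real.Gamma ((1 - s) / 2) := Real.Gamma_pos_of_pos (by linarith)
  have h2 : 0 < Real.Gamma (((n : ℝ) - (1 - s)) / 2) := Real.Gamma_pos_of_pos (by linarith)
  have h3 : (2 : ℝ) ^ (1 - s) = 2 / 2 ^ s := by rw [Real.rpow_sub two_pos, Real.rpow_one]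
  have h4 : (0 : ℝ) < 2 ^ s := by positivity
  have h5 : (0 : ℝ) < π ^ ((n : ℝ) / 2) := by positivity
  rw [rieszConst, rieszGamma, hg, h3]
  field_simp

theorem rieszConst_mul_integral_dirKernel {s : ℝ} (hn : 1 ≤ n) (hs0 : 0 < s) (hs1 : s < 1)
    (a ξ : EuclideanSpace ℝ (Fin n)) :
    (rieszConst n s : ℂ) * ∫ z, (1 - planeWave ξ (-z)) * (dirKernel s a z : ℂ) =
      dirSymbol s a ξ := by
  have : NeZero n := ⟨by omega⟩
  -- The increment is w(x) - w(x-z), so the frequency enters with a minus sign; this turns -i into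
  -- +i.
  have h := integral_one_sub_planeWave_mul_inner_mul_rpow hs0 hs1 (-ξ) a
  rw [finrank_euclideanSpace_fin] at h
  have e : ∀ z, planeWave (-ξ) z = planeWave ξ (-z) := fun z => by simp [planeWave]
  simp only [e] at h
  change _ * ∫ z, (1 - planeWave ξ (-z)) * (dirKernel s a z : ℂ) = _ at h
  have hG : (Real.Gamma (((n : ℝ) + s + 1) / 2) : ℂ) ≠ 0 := by
    exact_mod_cast (Real.Gamma_pos_of_pos (by positivity)).ne'
  have h1 : (0 : ℝ) < Real.Gamma ((1 - s) / 2) := Real.Gamma_pos_of_pos (by linarith)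
  have h5 : (0 : ℝ) < π ^ ((n : ℝ) / 2) := by positivity
  rw [rieszConst_eq hn hs0 hs1, Complex.ofReal_div, Complex.ofReal_mul, div_mul_eq_mul_div,
    mul_assoc, h, dirSymbol, Real.mul_rpow two_pos.le pi_pos.le, inner_neg_right, norm_neg]
  have h1' : (Real.Gamma ((1 - s) / 2) : ℂ) ≠ 0 := by exact_mod_cast h1.ne'
  have h5' : ((π ^ ((n : ℝ) / 2) : ℝ) : ℂ) ≠ 0 := by exact_mod_cast h5.ne'
  push_cast at h1' h5' ⊢
  rw [div_eq_iff (mul_ne_zero (by exact_mod_cast h5.ne') h1')]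
  ring

theorem lapConst_mul_integral {s : ℝ} (hn : 1 ≤ n) (hs0 : 0 < s) (hs1 : s < 1)
    (ξ : EuclideanSpace ℝ (Fin n)) :
    lapConst n s * ∫ z, (1 - Real.cos (2 * π * inner ℝ z ξ)) * ‖z‖ ^ (-((n : ℝ) + 2 * s)) =
      (2 * π * ‖ξ‖) ^ (2 * s) := by
  have : NeZero n := ⟨by omega⟩
  have h := integral_one_sub_cos_mul_rpow hs0 hs1 ξ
  rw [finrank_euclideanSpace_fin, show ((n : ℝ) + 2 * s) / 2 = (n : ℝ) / 2 + s by ring] at h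
  have h1 : (0 : ℝ) < Real.Gamma (1 - s) := Real.Gamma_pos_of_pos (by linarith)
  have h5 : (0 : ℝ) < π ^ ((n : ℝ) / 2) := by positivity
  have h4 : (4 : ℝ) ^ s = 2 ^ (2 * s) := by
    rw [Real.rpow_mul two_pos.le]; norm_num
  rw [lapConst, div_mul_eq_mul_div, mul_assoc, h, h4, mul_assoc 2 π,
    Real.mul_rpow two_pos.le (by positivity)]
  field_simp

/-- The symbol grows like |ξ|^s; the cruder linear bound keeps the moment count an integer. -/
theorem norm_dirSymbol_le {s : ℝ} (hs0 : 0 < s) (hs1 : s < 1)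
    (a ξ : EuclideanSpace ℝ (Fin n)) :
    ‖dirSymbol s a ξ‖ ≤ (2 * π) ^ s * ‖a‖ * (1 + ‖ξ‖) := by
  rcases eq_or_ne ξ 0 with rfl | hξ
  · simp only [dirSymbol, inner_zero_right, mul_zero, Complex.ofReal_zero, norm_zero]
    positivity
  have hξ : 0 < ‖ξ‖ := norm_pos_iff.2 hξ
  rw [dirSymbol, norm_mul, Complex.norm_I, one_mul, Complex.norm_real, norm_mul,
    Real.norm_of_nonneg (by positivity : 0 ≤ (2 * π) ^ s * ‖ξ‖ ^ (s - 1)), Real.norm_eq_abs]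
  have h1 : ‖ξ‖ ^ (s - 1) * ‖ξ‖ ≤ 1 + ‖ξ‖ := by
    rw [Real.rpow_sub_one hξ.ne', div_mul_cancel₀ _ hξ.ne']
    calc ‖ξ‖ ^ s ≤ (1 + ‖ξ‖) ^ s := by gcongr; linarith
      _ ≤ (1 + ‖ξ‖) ^ (1 : ℝ) := Real.rpow_le_rpow_of_exponent_le (by linarith) hs1.le
      _ = _ := Real.rpow_one _
  calc (2 * π) ^ s * ‖ξ‖ ^ (s - 1) * |inner ℝ a ξ|
      ≤ (2 * π) ^ s * ‖ξ‖ ^ (s - 1) * (‖a‖ * ‖ξ‖) := by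
        gcongr; exact abs_real_inner_le_norm a ξ
    _ = (2 * π) ^ s * ‖a‖ * (‖ξ‖ ^ (s - 1) * ‖ξ‖) := by ring
    _ ≤ _ := by gcongr

/-- The algebraic core of div^s D^s = Δ^s: i² = -1 and the squares of the coordinates of ξ add up to
|ξ|², raising |ξ|^(2s-2) to |ξ|^(2s). -/
theorem sum_dirSymbol_sq {s : ℝ} (hs0 : 0 < s) (ξ : EuclideanSpace ℝ (Fin n)) :
    ∑ j, dirSymbol s (EuclideanSpace.single j 1) ξ * dirSymbol s (EuclideanSpace.single j 1) ξ =
      -(((2 * π * ‖ξ‖) ^ (2 * s) : ℝ) : ℂ) := by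
  have e : ∀ j, dirSymbol s (EuclideanSpace.single j 1) ξ *
      dirSymbol s (EuclideanSpace.single j 1) ξ =
      ((-(((2 * π) ^ s * ‖ξ‖ ^ (s - 1)) ^ 2 * ξ j ^ 2) : ℝ) : ℂ) := by
    intro j
    rw [dirSymbol, mul_mul_mul_comm, Complex.I_mul_I]
    simp only [EuclideanSpace.inner_single_left, map_one, one_mul]
    push_cast; ring
  simp only [e]
  rw [← Complex.ofReal_sum, ← Complex.ofReal_neg, Finset.sum_neg_distrib, ← Finset.mul_sum]
  congr 2
  rw [← EuclideanSpace.real_norm_sq_eq]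
  rcases eq_or_ne ξ 0 with rfl | hξ
  · simp [Real.zero_rpow (by linarith : 2 * s ≠ 0)]
  have hξ : 0 < ‖ξ‖ := norm_pos_iff.2 hξ
  rw [Real.rpow_sub_one hξ.ne', mul_comm 2 s, Real.rpow_mul (by positivity),
    Real.mul_rpow (by positivity) hξ.le, Real.rpow_two]
  field_simp

end Symbols

/-! ### Singular integrals of superpositions of plane waves. -/

section Synthesis

variable {n : ℕ}

/-- `w` is the Fourier synthesis of `g`, and `g` has `k` finite absolute moments. -/
structure HasSpectrum (k : ℕ) (w : EuclideanSpace ℝ (Fin n) → ℝ)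
    (g : EuclideanSpace ℝ (Fin n) → ℂ) : Prop where
  aestronglyMeasurable : AEStronglyMeasurable g
  integrable_moment : Integrable fun ξ => (1 + ‖ξ‖) ^ k * ‖g ξ‖
  eq_integral : ∀ x, (w x : ℂ) = ∫ ξ, g ξ * planeWave ξ x

variable {k : ℕ} {w : EuclideanSpace ℝ (Fin n) → ℝ} {g : EuclideanSpace ℝ (Fin n) → ℂ}

theorem HasSpectrum.mono {l : ℕ} (h : HasSpectrum k w g) (hl : l ≤ k) : HasSpectrum l w g := by
  refine ⟨h.1, h.2.mono' ?_ (.of_forall fun ξ => ?_), h.3⟩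
  · exact AEStronglyMeasurable.mul (Continuous.aestronglyMeasurable (by fun_prop)) h.1.norm
  · rw [Real.norm_of_nonneg (by positivity)]
    gcongr
    linarith [norm_nonneg ξ]

theorem HasSpectrum.integrable (h : HasSpectrum k w g) : Integrable g := by
  have := (h.mono (Nat.zero_le k)).2
  simp only [pow_zero, one_mul] at this
  exact (integrable_norm_iff h.1).1 this

theorem continuous_planeWave_left (x : EuclideanSpace ℝ (Fin n)) :
    Continuous fun ξ => planeWave ξ x := by
  unfold planeWave; fun_prop

theorem HasSpectrum.integrable_mul_planeWave (h : HasSpectrum k w g)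
    (x : EuclideanSpace ℝ (Fin n)) : Integrable fun ξ => g ξ * planeWave ξ x :=
  h.integrable.mul_bdd (c := 1) (continuous_planeWave_left x).aestronglyMeasurable
    (.of_forall fun ξ => (norm_planeWave ξ x).le)

theorem HasSpectrum.sum {ι : Type*} (t : Finset ι)
    {w : ι → EuclideanSpace ℝ (Fin n) → ℝ} {g : ι → EuclideanSpace ℝ (Fin n) → ℂ}
    (h : ∀ i ∈ t, HasSpectrum k (w i) (g i)) :
    HasSpectrum k (fun x => ∑ i ∈ t, w i x) (fun ξ => ∑ i ∈ t, g i ξ) := by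
  have hm : AEStronglyMeasurable (fun ξ => ∑ i ∈ t, g i ξ) :=
    t.aestronglyMeasurable_fun_sum fun i hi => (h i hi).1
  refine ⟨hm, ?_, fun x => ?_⟩
  · refine Integrable.mono' (integrable_finsetSum t fun i hi => (h i hi).2)
      (AEStronglyMeasurable.mul (Continuous.aestronglyMeasurable (by fun_prop)) hm.norm)
      (.of_forall fun ξ => ?_)
    rw [Real.norm_of_nonneg (by positivity), ← Finset.mul_sum]
    gcongr
    exact norm_sum_le _ _
  · simp only [Finset.sum_mul]
    rw [integral_finsetSum t fun i hi => (h i hi).integrable_mul_planeWave x, Complex.ofReal_sum]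
    exact Finset.sum_congr rfl fun i hi => (h i hi).3 x

theorem integrable_of_integrable_ofReal {α : Type*} [MeasurableSpace α] {μ : Measure α}
    {f : α → ℝ} (h : Integrable (fun a => (f a : ℂ)) μ) : Integrable f μ := by
  simpa using h.re

/-- The spectral form of the integral defining a directional fractional derivative. -/
theorem HasSpectrum.integrable_and_integral (hn : 1 ≤ n) {s : ℝ} (hs0 : 0 < s) (hs1 : s < 1)
    (h : HasSpectrum 1 w g) (a x : EuclideanSpace ℝ (Fin n)) :
    Integrable (fun y => (w x - w y) * dirKernel s a (x - y)) ∧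
    ((rieszConst n s * ∫ y, (w x - w y) * dirKernel s a (x - y) : ℝ) : ℂ) =
      ∫ ξ, g ξ * dirSymbol s a ξ * planeWave ξ x := by
  have : NeZero n := ⟨by omega⟩
  let H : EuclideanSpace ℝ (Fin n) → EuclideanSpace ℝ (Fin n) → ℂ := fun z ξ =>
    (g ξ * planeWave ξ x) * ((1 - planeWave ξ (-z)) * (dirKernel s a z : ℂ))
  have hker : Integrable fun z : EuclideanSpace ℝ (Fin n) =>
      min 1 (‖z‖ ^ 1) * ‖z‖ ^ (-((n : ℝ) + s)) :=
    integrable_min_one_norm_pow_mul_rpow (k := 1)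
      (by rw [finrank_euclideanSpace_fin]; linarith)
      (by rw [finrank_euclideanSpace_fin]; push_cast; linarith)
  have hH : Integrable (Function.uncurry H) (volume.prod volume) := by
    -- The majorant is a product: the truncated kernel in z times the first-moment density in ξ.
    have hb := (hker.const_mul (2 * π * ‖a‖)).mul_prod h.2
    refine hb.mono' ?_ (.of_forall fun q => ?_)
    · have h1 : AEStronglyMeasurable
          (fun q : EuclideanSpace ℝ (Fin n) × EuclideanSpace ℝ (Fin n) => g q.2)
          (volume.prod volume) := h.1.comp_snd
      refine AEStronglyMeasurable.mul (h1.mul ?_) (AEStronglyMeasurable.mul ?_ ?_)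
      · exact Continuous.aestronglyMeasurable (by unfold planeWave; fun_prop)
      · exact Continuous.aestronglyMeasurable (by unfold planeWave; fun_prop)
      · refine Measurable.aestronglyMeasurable ?_
        exact Complex.measurable_ofReal.comp ((measurable_dirKernel s a).comp measurable_fst)
    · obtain ⟨z, ξ⟩ := q
      simp only [Function.uncurry, H]
      have h1 := norm_one_sub_planeWave_mul_inner_mul_rpow_le (-ξ) z a ((n : ℝ) + s)
      rw [show planeWave (-ξ) z = planeWave ξ (-z) by simp [planeWave], norm_neg] at h1
      rw [norm_mul, norm_mul, norm_planeWave, mul_one]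
      calc _ ≤ ‖g ξ‖ * (2 * π * (1 + ‖ξ‖) * ‖a‖ *
            (min 1 (‖z‖ ^ 1) * ‖z‖ ^ (-((n : ℝ) + s)))) := by gcongr; exact h1
        _ = _ := by rw [pow_one]; ring
  have hS : ∀ z, (((w x - w (x - z)) * dirKernel s a z : ℝ) : ℂ) = ∫ ξ, H z ξ := by
    intro z
    have e : ∀ ξ, H z ξ = (g ξ * planeWave ξ x - g ξ * planeWave ξ (x - z)) *
        (dirKernel s a z : ℂ) := by
      intro ξ; simp only [H]; rw [planeWave_sub]; ring
    simp only [e]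
    rw [integral_mul_const, integral_sub (h.integrable_mul_planeWave x)
      (h.integrable_mul_planeWave (x - z)), ← h.3, ← h.3]
    push_cast; rfl
  have hSi : Integrable fun z => (w x - w (x - z)) * dirKernel s a z := by
    refine integrable_of_integrable_ofReal (hH.integral_prod_left.congr (.of_forall fun z => ?_))
    exact (hS z).symm
  have hy : ∀ y, (w x - w y) * dirKernel s a (x - y) =
      (fun z => (w x - w (x - z)) * dirKernel s a z) (x - y) := by
    intro y; simp
  simp only [hy]
  refine ⟨hSi.comp_sub_left x, ?_⟩
  rw [integral_sub_left_eq_self (fun z => (w x - w (x - z)) * dirKernel s a z) volume x,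
    Complex.ofReal_mul, ← integral_complex_ofReal]
  simp only [hS]
  rw [integral_integral_swap hH, ← integral_const_mul]
  refine integral_congr_ae (.of_forall fun ξ => ?_)
  simp only [H]
  rw [integral_const_mul, ← rieszConst_mul_integral_dirKernel hn hs0 hs1 a ξ]
  ring

/-- This closure property allows the operators to be iterated: neither decay nor compact support of
`w` is used, only moments of its spectrum. -/
theorem HasSpectrum.dirDeriv (hn : 1 ≤ n) {s : ℝ} (hs0 : 0 < s) (hs1 : s < 1)
    (h : HasSpectrum (k + 1) w g) (a : EuclideanSpace ℝ (Fin n)) :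
    HasSpectrum k (fun x => rieszConst n s * ∫ y, (w x - w y) * dirKernel s a (x - y))
      (fun ξ => g ξ * dirSymbol s a ξ) := by
  have hm : AEStronglyMeasurable fun ξ => g ξ * dirSymbol s a ξ :=
    h.1.mul (measurable_dirSymbol s a).aestronglyMeasurable
  refine ⟨hm, ?_, fun x => ((h.mono (by omega)).integrable_and_integral hn hs0 hs1 a x).2⟩
  refine (h.2.const_mul ((2 * π) ^ s * ‖a‖)).mono'
    (AEStronglyMeasurable.mul (Continuous.aestronglyMeasurable (by fun_prop)) hm.norm)
    (.of_forall fun ξ => ?_)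
  rw [Real.norm_of_nonneg (by positivity), norm_mul]
  calc (1 + ‖ξ‖) ^ k * (‖g ξ‖ * ‖dirSymbol s a ξ‖)
      ≤ (1 + ‖ξ‖) ^ k * (‖g ξ‖ * ((2 * π) ^ s * ‖a‖ * (1 + ‖ξ‖))) := by
        gcongr; exact norm_dirSymbol_le hs0 hs1 a ξ
    _ = _ := by ring

theorem integrableOn_compl_ball_of_bounded (hn : 1 ≤ n) {p : ℝ} (hp : (n : ℝ) < p)
    {f : EuclideanSpace ℝ (Fin n) → ℝ} (hf : Continuous f) {C : ℝ} (hC : ∀ z, |f z| ≤ C)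
    {ε : ℝ} (hε : 0 < ε) :
    IntegrableOn (fun z => f z * ‖z‖ ^ (-p)) (Metric.ball 0 ε)ᶜ := by
  have : NeZero n := ⟨by omega⟩
  -- Away from the origin the truncation order is irrelevant; any k > p makes the majorant
  -- integrable.
  obtain ⟨k, hk⟩ := exists_nat_gt p
  have hker : Integrable fun z : EuclideanSpace ℝ (Fin n) =>
      min 1 (‖z‖ ^ k) * ‖z‖ ^ (-p) :=
    integrable_min_one_norm_pow_mul_rpow
      (by rw [finrank_euclideanSpace_fin]; linarith)
      (by rw [finrank_euclideanSpace_fin]; linarith [(Nat.cast_nonneg n : (0 : ℝ) ≤ n)])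
  have hm : 0 < min 1 (ε ^ k) := by positivity
  refine (hker.integrableOn.const_mul (C / min 1 (ε ^ k))).mono'
    (Measurable.aestronglyMeasurable (by fun_prop))
    ((ae_restrict_iff' Metric.isOpen_ball.measurableSet.compl).2 (.of_forall fun z hz => ?_))
  have hz : ε ≤ ‖z‖ := by simpa using hz
  have h1 : min 1 (ε ^ k) ≤ min 1 (‖z‖ ^ k) := by gcongr
  have hC0 : 0 ≤ C := (abs_nonneg _).trans (hC z)
  rw [norm_mul, Real.norm_eq_abs, Real.norm_of_nonneg (by positivity), ← mul_assoc]
  gcongr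
  calc |f z| ≤ C := hC z
    _ = C / min 1 (ε ^ k) * min 1 (ε ^ k) := by field_simp
    _ ≤ _ := by gcongr

/-- The symmetrised form of the principal value. On a plane wave the second difference is -2(1 -
cos(2π⟨z,ξ⟩)) times the wave, which is quadratically small at z = 0, so the integral converges
absolutely for all 0 < s < 1. -/
theorem HasSpectrum.integrable_and_integral_secondDiff (hn : 1 ≤ n) {s : ℝ} (hs0 : 0 < s)
    (hs1 : s < 1) (h : HasSpectrum 2 w g) (x : EuclideanSpace ℝ (Fin n)) :
    Integrable (fun z => (w (x - z) + w (x + z) - 2 * w x) * ‖z‖ ^ (-((n : ℝ) + 2 * s))) ∧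
    ((lapConst n s * (1 / 2 * ∫ z, (w (x - z) + w (x + z) - 2 * w x) *
        ‖z‖ ^ (-((n : ℝ) + 2 * s))) : ℝ) : ℂ) =
      ∫ ξ, g ξ * (-(((2 * π * ‖ξ‖) ^ (2 * s) : ℝ) : ℂ)) * planeWave ξ x := by
  have : NeZero n := ⟨by omega⟩
  let H : EuclideanSpace ℝ (Fin n) → EuclideanSpace ℝ (Fin n) → ℂ := fun z ξ =>
    (g ξ * planeWave ξ x * (-2)) *
      (((1 - Real.cos (2 * π * inner ℝ z ξ)) * ‖z‖ ^ (-((n : ℝ) + 2 * s)) : ℝ) : ℂ)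
  have hker : Integrable fun z : EuclideanSpace ℝ (Fin n) =>
      min 1 (‖z‖ ^ 2) * ‖z‖ ^ (-((n : ℝ) + 2 * s)) :=
    integrable_min_one_norm_pow_mul_rpow (k := 2)
      (by rw [finrank_euclideanSpace_fin]; linarith)
      (by rw [finrank_euclideanSpace_fin]; push_cast; linarith)
  have hH : Integrable (Function.uncurry H) (volume.prod volume) := by
    have hb := (hker.const_mul (2 * (2 * π ^ 2))).mul_prod h.2
    refine hb.mono' ?_ (.of_forall fun q => ?_)
    · have h1 : AEStronglyMeasurable
          (fun q : EuclideanSpace ℝ (Fin n) × EuclideanSpace ℝ (Fin n) => g q.2)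
          (volume.prod volume) := h.1.comp_snd
      refine AEStronglyMeasurable.mul ((h1.mul ?_).mul_const _) ?_
      · exact Continuous.aestronglyMeasurable (by unfold planeWave; fun_prop)
      · exact (Complex.measurable_ofReal.comp (by fun_prop)).aestronglyMeasurable
    · obtain ⟨z, ξ⟩ := q
      simp only [Function.uncurry, H]
      have h0 := one_sub_cos_inner_nonneg ξ z
      have h1 := one_sub_cos_inner_le ξ z
      rw [norm_mul, norm_mul, norm_mul, norm_planeWave, mul_one, Complex.norm_real,
        Real.norm_of_nonneg (by positivity), norm_neg, Complex.norm_ofNat]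
      calc _ ≤ ‖g ξ‖ * 2 * (2 * π ^ 2 * (1 + ‖ξ‖) ^ 2 * min 1 (‖z‖ ^ 2) *
            ‖z‖ ^ (-((n : ℝ) + 2 * s))) := by gcongr
        _ = _ := by ring
  have hS : ∀ z, (((w (x - z) + w (x + z) - 2 * w x) * ‖z‖ ^ (-((n : ℝ) + 2 * s)) : ℝ) : ℂ) =
      ∫ ξ, H z ξ := by
    intro z
    have e : ∀ ξ, H z ξ = (g ξ * planeWave ξ (x - z) + g ξ * planeWave ξ (x + z) -
        2 * (g ξ * planeWave ξ x)) * ((‖z‖ ^ (-((n : ℝ) + 2 * s)) : ℝ) : ℂ) := by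
      intro ξ
      have h1 : planeWave ξ (x + z) = planeWave ξ x * planeWave ξ z := by
        have := planeWave_sub ξ x (-z)
        rwa [sub_neg_eq_add, neg_neg] at this
      simp only [H]
      rw [planeWave_sub, h1, Complex.ofReal_mul, Complex.ofReal_sub, ofReal_cos_inner]
      push_cast; ring
    simp only [e]
    have i1 := h.integrable_mul_planeWave (x - z)
    have i2 := h.integrable_mul_planeWave (x + z)
    have i3 := h.integrable_mul_planeWave x
    rw [integral_mul_const, integral_sub (i1.fun_add i2) (i3.const_mul 2),
      integral_add i1 i2, integral_const_mul, ← h.3, ← h.3, ← h.3]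
    push_cast; rfl
  refine ⟨integrable_of_integrable_ofReal (hH.integral_prod_left.congr
    (.of_forall fun z => (hS z).symm)), ?_⟩
  rw [Complex.ofReal_mul, Complex.ofReal_mul, ← integral_complex_ofReal]
  simp only [hS]
  rw [integral_integral_swap hH, ← integral_const_mul, ← integral_const_mul]
  refine integral_congr_ae (.of_forall fun ξ => ?_)
  simp only [H]
  rw [integral_const_mul, integral_complex_ofReal, ← lapConst_mul_integral hn hs0 hs1 ξ]
  push_cast
  ring

/-- The complement of a centred ball is invariant under z ↦ -z, so each truncated integral is half
the truncated integral of the second difference. Dominated convergence then removes the truncation.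
-/
theorem HasSpectrum.tendsto_truncated (hn : 1 ≤ n) {s : ℝ} (hs0 : 0 < s)
    (hs1 : s < 1) (h : HasSpectrum 2 w g) (hw : Continuous w) {C : ℝ} (hC : ∀ x, |w x| ≤ C)
    (x : EuclideanSpace ℝ (Fin n)) {L : ℝ}
    (hL : (L : ℂ) = ∫ ξ, g ξ * (-(((2 * π * ‖ξ‖) ^ (2 * s) : ℝ) : ℂ)) * planeWave ξ x) :
    (∀ ε : ℝ, 0 < ε → IntegrableOn (fun y => 1 / ‖x - y‖ ^ ((n : ℝ) + 2 * s) * (w y - w x))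
      (Metric.ball x ε)ᶜ) ∧
    Tendsto (fun ε => lapConst n s * ∫ y in (Metric.ball x ε)ᶜ,
      1 / ‖x - y‖ ^ ((n : ℝ) + 2 * s) * (w y - w x)) (𝓝[>] 0) (𝓝 L) := by
  set p := (n : ℝ) + 2 * s with hp
  obtain ⟨hSi, hS⟩ := h.integrable_and_integral_secondDiff hn hs0 hs1 x
  rw [← hL, Complex.ofReal_inj] at hS
  rw [← hp] at hSi hS
  let q : EuclideanSpace ℝ (Fin n) → ℝ := fun z => (w (x - z) - w x) * ‖z‖ ^ (-p)
  have hq : ∀ ε : ℝ, 0 < ε → IntegrableOn q (Metric.ball 0 ε)ᶜ := by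
    intro ε hε
    refine integrableOn_compl_ball_of_bounded hn (by linarith) (by fun_prop) (C := C + C)
      (fun z => ?_) hε
    exact (abs_sub _ _).trans (add_le_add (hC _) (hC _))
  have hms : ∀ (x : EuclideanSpace ℝ (Fin n)) (ε : ℝ), MeasurableSet (Metric.ball x ε)ᶜ :=
    fun x ε => Metric.isOpen_ball.measurableSet.compl
  have e : ∀ ε : ℝ, (Metric.ball x ε)ᶜ.indicator
      (fun y => 1 / ‖x - y‖ ^ p * (w y - w x)) =
      fun y => (Metric.ball 0 ε)ᶜ.indicator q (x - y) := by
    intro ε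
    funext y
    have hmem : y ∈ (Metric.ball x ε)ᶜ ↔
        x - y ∈ (Metric.ball (0 : EuclideanSpace ℝ (Fin n)) ε)ᶜ := by
      simp [dist_eq_norm, norm_sub_rev]
    by_cases hy : y ∈ (Metric.ball x ε)ᶜ
    · rw [indicator_of_mem hy, indicator_of_mem (hmem.1 hy)]
      simp only [q, sub_sub_cancel]
      rw [Real.rpow_neg (norm_nonneg _), one_div, mul_comm]
    · rw [indicator_of_notMem hy, indicator_of_notMem (mt hmem.2 hy)]
  have hint : ∀ ε : ℝ, 0 < ε → ∫ y in (Metric.ball x ε)ᶜ, 1 / ‖x - y‖ ^ p * (w y - w x) =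
      1 / 2 * ∫ z, (Metric.ball 0 ε)ᶜ.indicator
        (fun z => (w (x - z) + w (x + z) - 2 * w x) * ‖z‖ ^ (-p)) z := by
    intro ε hε
    have hqi := (integrable_indicator_iff (hms 0 ε)).2 (hq ε hε)
    rw [← integral_indicator (hms x ε), e ε,
      integral_sub_left_eq_self ((Metric.ball 0 ε)ᶜ.indicator q) volume x]
    have h2 : ∀ z, (Metric.ball 0 ε)ᶜ.indicator
        (fun z => (w (x - z) + w (x + z) - 2 * w x) * ‖z‖ ^ (-p)) z =
        (Metric.ball 0 ε)ᶜ.indicator q z + (Metric.ball 0 ε)ᶜ.indicator q (-z) := by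
      intro z
      by_cases hz : z ∈ (Metric.ball (0 : EuclideanSpace ℝ (Fin n)) ε)ᶜ
      · have hz' : -z ∈ (Metric.ball (0 : EuclideanSpace ℝ (Fin n)) ε)ᶜ := by simpa using hz
        rw [indicator_of_mem hz, indicator_of_mem hz, indicator_of_mem hz']
        simp only [q, norm_neg, sub_neg_eq_add]
        ring
      · have hz' : -z ∉ (Metric.ball (0 : EuclideanSpace ℝ (Fin n)) ε)ᶜ := by simpa using hz
        rw [indicator_of_notMem hz, indicator_of_notMem hz, indicator_of_notMem hz', add_zero]
    simp only [h2]
    rw [integral_add hqi hqi.comp_neg, integral_neg_eq_self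
      ((Metric.ball 0 ε)ᶜ.indicator q) volume]
    ring
  refine ⟨fun ε hε => ?_, ?_⟩
  · rw [← integrable_indicator_iff (hms x ε), e ε]
    exact ((integrable_indicator_iff (hms 0 ε)).2 (hq ε hε)).comp_sub_left x
  · rw [← hS]
    refine Tendsto.const_mul _ ?_
    have hT : Tendsto (fun ε : ℝ => 1 / 2 * ∫ z, (Metric.ball 0 ε)ᶜ.indicator
        (fun z => (w (x - z) + w (x + z) - 2 * w x) * ‖z‖ ^ (-p)) z) (𝓝[>] 0)
        (𝓝 (1 / 2 * ∫ z, (w (x - z) + w (x + z) - 2 * w x) * ‖z‖ ^ (-p))) := by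
      refine Tendsto.const_mul _ ?_
      refine tendsto_integral_filter_of_dominated_convergence _
        (.of_forall fun ε => hSi.1.indicator (hms 0 ε)) (.of_forall fun ε => .of_forall fun z =>
          norm_indicator_le_norm_self _ z) hSi.norm (.of_forall fun z => ?_)
      -- At the origin the second difference vanishes; any other z lies outside the ball once ε <
      -- |z|.
      rcases eq_or_ne z 0 with rfl | hz
      · have : ∀ ε : ℝ, (Metric.ball 0 ε)ᶜ.indicator
            (fun z => (w (x - z) + w (x + z) - 2 * w x) * ‖z‖ ^ (-p)) 0 = 0 := by
          intro ε
          refine indicator_apply_eq_zero.2 fun _ => ?_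
          rw [sub_zero, add_zero]; ring
        simp only [this]
        rw [sub_zero, add_zero, show w x + w x - 2 * w x = 0 by ring, zero_mul]
        exact tendsto_const_nhds
      · refine tendsto_const_nhds.congr' ?_
        filter_upwards [Ioo_mem_nhdsGT (norm_pos_iff.2 hz)] with ε hε
        rw [indicator_of_mem]
        simpa using hε.2.le
    refine hT.congr' ?_
    filter_upwards [self_mem_nhdsWithin] with ε hε
    exact (hint ε hε).symm

/-- A smooth compactly supported function is the Fourier synthesis of its Fourier transform. -/
theorem exists_hasSpectrum (hw : ContDiff ℝ ∞ w) (hc : HasCompactSupport w) (k : ℕ) :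
    ∃ g, HasSpectrum k w g := by
  let f : SchwartzMap (EuclideanSpace ℝ (Fin n)) ℂ :=
    (hc.comp_left (g := ((↑) : ℝ → ℂ)) Complex.ofReal_zero).toSchwartzMap
      (Complex.ofRealCLM.contDiff.comp hw)
  let F : SchwartzMap (EuclideanSpace ℝ (Fin n)) ℂ := FourierTransform.fourier f
  refine ⟨F, F.continuous.aestronglyMeasurable, ?_, fun x => ?_⟩
  · have hi : Integrable (fun ξ => (2 : ℝ) ^ k * (‖ξ‖ ^ 0 * ‖F ξ‖ + ‖ξ‖ ^ k * ‖F ξ‖)) :=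
      ((F.integrable_pow_mul volume 0).add (F.integrable_pow_mul volume k)).const_mul _
    refine hi.mono' (Continuous.aestronglyMeasurable
      (by have := F.continuous; fun_prop)) (.of_forall fun ξ => ?_)
    rw [Real.norm_of_nonneg (by positivity), ← add_mul, ← mul_assoc, pow_zero]
    gcongr
    have h1 := norm_nonneg ξ
    rcases le_total 1 ‖ξ‖ with h2 | h2
    · calc (1 + ‖ξ‖) ^ k ≤ (2 * ‖ξ‖) ^ k := by gcongr; linarith
        _ = 2 ^ k * ‖ξ‖ ^ k := mul_pow _ _ _
        _ ≤ _ := by gcongr; linarith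
    · calc (1 + ‖ξ‖) ^ k ≤ 2 ^ k := by gcongr; linarith
        _ ≤ _ := le_mul_of_one_le_right (by positivity) (by linarith [pow_nonneg h1 k])
  · have hinv : FourierTransformInv.fourierInv F = f := FourierTransform.fourierInv_fourier_eq f
    have h1 : (FourierTransformInv.fourierInv F) x = (w x : ℂ) := by rw [hinv]; rfl
    rw [← h1, SchwartzMap.fourierInv_coe, Real.fourierInv_eq']
    refine integral_congr_ae (.of_forall fun ξ => ?_)
    simp only [planeWave, smul_eq_mul]
    rw [real_inner_comm, mul_comm]

end Synthesis

/-! ### Reduction of the vector and matrix operators to scalar components. -/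

section Components

variable {n : ℕ}

/-- Collecting the quotient's 1/|z| with the kernel gives the total power n+s+1, so every
first-order operator is a combination of scalar integrals against `dirKernel`. At z = 0 both sides
are 0. -/
theorem inv_norm_mul_rieszKernel (s : ℝ) (z : EuclideanSpace ℝ (Fin n)) (j : Fin n) :
    ‖z‖⁻¹ * rieszKernel s z j = dirKernel s (EuclideanSpace.single j 1) z := by
  rcases eq_or_ne z 0 with rfl | hz
  · simp [rieszKernel, dirKernel]
  have hz : 0 < ‖z‖ := norm_pos_iff.2 hz
  have h : ‖z‖ ^ (-((n : ℝ) + s + 1)) = ‖z‖⁻¹ * ‖z‖⁻¹ / ‖z‖ ^ ((n : ℝ) - 1 + s) := by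
    rw [← Real.rpow_neg_one, ← Real.rpow_add hz, ← Real.rpow_sub hz]
    congr 1; ring
  simp only [rieszKernel, dirKernel, PiLp.smul_apply, smul_eq_mul, h,
    EuclideanSpace.inner_single_right, starRingEnd_apply, star_trivial, one_mul]
  ring

theorem gradIntegrand_apply (s : ℝ) (u : EuclideanSpace ℝ (Fin n) → ℝ)
    (x y : EuclideanSpace ℝ (Fin n)) (j : Fin n) :
    gradIntegrand s u x y j =
      (u x - u y) * dirKernel s (EuclideanSpace.single j 1) (x - y) := by
  rw [← inv_norm_mul_rieszKernel]
  simp only [gradIntegrand, PiLp.smul_apply, smul_eq_mul]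
  ring

theorem vecGradIntegrand_apply (s : ℝ) (u : EuclideanSpace ℝ (Fin n) → EuclideanSpace ℝ (Fin n))
    (x y : EuclideanSpace ℝ (Fin n)) (i j : Fin n) :
    vecGradIntegrand s u x y i j =
      (u x i - u y i) * dirKernel s (EuclideanSpace.single j 1) (x - y) := by
  rw [← inv_norm_mul_rieszKernel]
  simp only [vecGradIntegrand, Matrix.vecMulVec_apply, PiLp.smul_apply, PiLp.sub_apply,
    smul_eq_mul]
  ring

theorem divIntegrand_eq_sum (s : ℝ) (u : EuclideanSpace ℝ (Fin n) → EuclideanSpace ℝ (Fin n))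
    (x y : EuclideanSpace ℝ (Fin n)) :
    divIntegrand s u x y = ∑ j, vecGradIntegrand s u x y j j := by
  simp only [divIntegrand, vecGradIntegrand, Matrix.vecMulVec_apply, PiLp.inner_apply,
    RCLike.inner_apply, conj_trivial]
  exact Finset.sum_congr rfl fun j _ => mul_comm _ _

theorem matDivIntegrand_apply (s : ℝ)
    (Φ : EuclideanSpace ℝ (Fin n) → Matrix (Fin n) (Fin n) ℝ)
    (x y : EuclideanSpace ℝ (Fin n)) (i : Fin n) :
    matDivIntegrand s Φ x y i =
      ∑ j, (Φ x i j - Φ y i j) * dirKernel s (EuclideanSpace.single j 1) (x - y) := by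
  simp only [matDivIntegrand, Matrix.mulVec, dotProduct]
  refine Finset.sum_congr rfl fun j _ => ?_
  rw [← inv_norm_mul_rieszKernel]
  simp only [Matrix.smul_apply, Matrix.sub_apply, smul_eq_mul]
  ring

theorem matDivIntegrand_smul_one (s : ℝ) (u : EuclideanSpace ℝ (Fin n) → ℝ)
    (x : EuclideanSpace ℝ (Fin n)) :
    matDivIntegrand s (fun y => u y • (1 : Matrix (Fin n) (Fin n) ℝ)) x = gradIntegrand s u x := by
  funext y
  ext i
  rw [matDivIntegrand_apply, gradIntegrand_apply, Finset.sum_eq_single i]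
  · simp
  · intro j _ hj
    simp [Matrix.one_apply_ne hj.symm]
  · simp

theorem lapIntegrand_apply (s : ℝ) (u : EuclideanSpace ℝ (Fin n) → EuclideanSpace ℝ (Fin n))
    (x y : EuclideanSpace ℝ (Fin n)) (i : Fin n) :
    lapIntegrand s u x y i = 1 / ‖x - y‖ ^ ((n : ℝ) + 2 * s) * (u y i - u x i) := by
  simp [lapIntegrand]

theorem vecFracGrad_apply (s : ℝ) (u : EuclideanSpace ℝ (Fin n) → EuclideanSpace ℝ (Fin n))
    (x : EuclideanSpace ℝ (Fin n)) (i j : Fin n) :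
    vecFracGrad s u x i j = rieszConst n s * ∫ y,
      (u x i - u y i) * dirKernel s (EuclideanSpace.single j 1) (x - y) := by
  simp only [vecFracGrad, Matrix.of_apply, vecGradIntegrand_apply]

theorem trace_vecFracGrad {s : ℝ} {u : EuclideanSpace ℝ (Fin n) → EuclideanSpace ℝ (Fin n)}
    {x : EuclideanSpace ℝ (Fin n)}
    (h : ∀ i j, Integrable fun y => vecGradIntegrand s u x y i j) :
    (vecFracGrad s u x).trace = fracDiv s u x := by
  simp only [fracDiv, divIntegrand_eq_sum]
  rw [integral_finsetSum _ fun j _ => h j j, Finset.mul_sum]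
  rfl

/-- With this formula, equality of two fractional divergences is a pointwise identity between
symbols under the ξ-integral. -/
theorem integrable_matDivIntegrand_and_matFracDiv (hn : 1 ≤ n) {s : ℝ} (hs0 : 0 < s)
    (hs1 : s < 1) {Φ : EuclideanSpace ℝ (Fin n) → Matrix (Fin n) (Fin n) ℝ}
    {G : Fin n → Fin n → EuclideanSpace ℝ (Fin n) → ℂ}
    (h : ∀ i j, HasSpectrum 1 (fun x => Φ x i j) (G i j)) (x : EuclideanSpace ℝ (Fin n)) :
    Integrable (matDivIntegrand s Φ x) ∧ ∀ i, ((matFracDiv s Φ x i : ℝ) : ℂ) =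
      ∫ ξ, (∑ j, G i j ξ * dirSymbol s (EuclideanSpace.single j 1) ξ) * planeWave ξ x := by
  have hi : ∀ i j, Integrable fun y =>
      (Φ x i j - Φ y i j) * dirKernel s (EuclideanSpace.single j 1) (x - y) := fun i j =>
    ((h i j).integrable_and_integral hn hs0 hs1 _ x).1
  have hsum : ∀ i, Integrable fun y => matDivIntegrand s Φ x y i := fun i => by
    simp only [matDivIntegrand_apply]
    exact integrable_finsetSum _ fun j _ => hi i j
  refine ⟨Integrable.of_eval_piLp hsum, fun i => ?_⟩
  rw [matFracDiv, PiLp.smul_apply, eval_integral_piLp hsum, smul_eq_mul]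
  simp only [matDivIntegrand_apply]
  rw [integral_finsetSum _ fun j _ => hi i j, Finset.mul_sum, Complex.ofReal_sum]
  simp only [Finset.sum_mul]
  rw [integral_finsetSum]
  · exact Finset.sum_congr rfl fun j _ => ((h i j).integrable_and_integral hn hs0 hs1 _ x).2
  · exact fun j _ => ((h i j).dirDeriv (k := 0) hn hs0 hs1 _).integrable_mul_planeWave x

theorem isoTensor_symPart (mu lam : ℝ) (H : Matrix (Fin n) (Fin n) ℝ) :
    isoTensor mu lam (symPart H) = mu • H + mu • Hᵀ + lam • (H.trace • 1) := by
  have : (symPart H).trace = H.trace := by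
    rw [symPart, Matrix.trace_smul, Matrix.trace_add, Matrix.trace_transpose, smul_eq_mul]
    ring
  rw [isoTensor, this, symPart, smul_smul, ← smul_smul lam, show 2 * mu * (1 / 2) = mu by ring,
    smul_add]

end Components

/-- Convergence is checked in each coordinate. The limit is left free, so it can be chosen to be
div^s D^s v. -/
theorem tendsto_truncLap {n : ℕ} (hn : 1 ≤ n) {s : ℝ} (hs0 : 0 < s) (hs1 : s < 1)
    {v : EuclideanSpace ℝ (Fin n) → EuclideanSpace ℝ (Fin n)}
    {g : Fin n → EuclideanSpace ℝ (Fin n) → ℂ}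
    (h : ∀ i, HasSpectrum 2 (fun x => v x i) (g i)) (hv : Continuous v)
    (hvc : HasCompactSupport v) (x L : EuclideanSpace ℝ (Fin n))
    (hL : ∀ i, (L i : ℂ) =
      ∫ ξ, g i ξ * (-(((2 * π * ‖ξ‖) ^ (2 * s) : ℝ) : ℂ)) * planeWave ξ x) :
    (∀ ε : ℝ, 0 < ε → IntegrableOn (lapIntegrand s v x) (Metric.ball x ε)ᶜ) ∧
      Tendsto (truncLap s v x) (𝓝[>] 0) (𝓝 L) := by
  obtain ⟨C, hC⟩ := hvc.exists_bound_of_continuous hv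
  have key := fun i => (h i).tendsto_truncated hn hs0 hs1 (by fun_prop) (C := C)
    (fun z => (PiLp.norm_apply_le (v z) i).trans (hC z)) x (hL i)
  have hi : ∀ ε : ℝ, 0 < ε → ∀ i,
      IntegrableOn (fun y => lapIntegrand s v x y i) (Metric.ball x ε)ᶜ := fun ε hε i => by
    simp only [lapIntegrand_apply]
    exact (key i).1 ε hε
  refine ⟨fun ε hε => Integrable.of_eval_piLp (hi ε hε), ?_⟩
  rw [(PiLp.homeomorph 2 fun _ : Fin n => ℝ).isInducing.tendsto_nhds_iff, tendsto_pi_nhds]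
  intro i
  refine ((key i).2).congr' ?_
  filter_upwards [self_mem_nhdsWithin] with ε hε
  change _ = truncLap s v x ε i
  rw [truncLap, PiLp.smul_apply, eval_integral_piLp (hi ε hε), smul_eq_mul]
  simp only [lapIntegrand_apply]

end FracElasticity
-- The identities and the Navier system.
theorem mainTheorem9 (n : ℕ) (hn : 1 ≤ n) (s : ℝ) (hs0 : 0 < s) (hs1 : s < 1)
    (Ω : Set (EuclideanSpace ℝ (Fin n))) (hΩ : IsOpen Ω)
    (v : EuclideanSpace ℝ (Fin n) → EuclideanSpace ℝ (Fin n))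
    (hv : ContDiff ℝ ∞ v) (hvc : HasCompactSupport v) (hvΩ : tsupport v ⊆ Ω) :
    -- every integral below converges absolutely and the principal value exists
    (∀ x : EuclideanSpace ℝ (Fin n),
      (∀ i j, Integrable (fun y => FracElasticity.vecGradIntegrand s v x y i j)) ∧
      Integrable (FracElasticity.divIntegrand s v x) ∧
      Integrable (FracElasticity.gradIntegrand s (FracElasticity.fracDiv s v) x) ∧
      Integrable (FracElasticity.matDivIntegrand s
        (fun y => FracElasticity.fracDiv s v y • (1 : Matrix (Fin n) (Fin n) ℝ)) x) ∧
      Integrable (FracElasticity.matDivIntegrand s (FracElasticity.vecFracGrad s v) x) ∧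
      Integrable (FracElasticity.matDivIntegrand s
        (fun y => (FracElasticity.vecFracGrad s v y)ᵀ) x) ∧
      (∀ ε : ℝ, 0 < ε →
        IntegrableOn (FracElasticity.lapIntegrand s v x) (Metric.ball x ε)ᶜ) ∧
      Tendsto (FracElasticity.truncLap s v x) (𝓝[>] (0 : ℝ))
        (𝓝 (FracElasticity.fracLap s v x))) ∧
    -- the four identities
    (∀ x, (FracElasticity.vecFracGrad s v x).trace = FracElasticity.fracDiv s v x) ∧
    (∀ x, FracElasticity.matFracDiv s
        (fun y => FracElasticity.fracDiv s v y • (1 : Matrix (Fin n) (Fin n) ℝ)) x =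
      FracElasticity.fracGrad s (FracElasticity.fracDiv s v) x) ∧
    (∀ x, FracElasticity.matFracDiv s (FracElasticity.vecFracGrad s v) x =
      FracElasticity.fracLap s v x) ∧
    (∀ x, FracElasticity.matFracDiv s (fun y => (FracElasticity.vecFracGrad s v y)ᵀ) x =
      FracElasticity.fracGrad s (FracElasticity.fracDiv s v) x) ∧
    -- the strong form of the isotropic fractional Navier equation
    (∀ mu lam : ℝ,
      (∀ x,
        Integrable (FracElasticity.matDivIntegrand s (fun y => FracElasticity.isoTensor mu lam
          (FracElasticity.symPart (FracElasticity.vecFracGrad s v y))) x) ∧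
        FracElasticity.matFracDiv s (fun y => FracElasticity.isoTensor mu lam
            (FracElasticity.symPart (FracElasticity.vecFracGrad s v y))) x =
          mu • FracElasticity.fracLap s v x +
            (mu + lam) • FracElasticity.fracGrad s (FracElasticity.fracDiv s v) x) ∧
      ∀ f : EuclideanSpace ℝ (Fin n) → EuclideanSpace ℝ (Fin n),
        ((∀ x ∈ Ω, -FracElasticity.matFracDiv s (fun y => FracElasticity.isoTensor mu lam
            (FracElasticity.symPart (FracElasticity.vecFracGrad s v y))) x = f x) ∧
          (∀ x ∈ Ωᶜ, v x = 0)) ↔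
        ((∀ x ∈ Ω, -(mu • FracElasticity.fracLap s v x) -
            (mu + lam) • FracElasticity.fracGrad s (FracElasticity.fracDiv s v) x = f x) ∧
          (∀ x ∈ Ωᶜ, v x = 0))) := by
  -- Two moments suffice: one is spent on D^s v, the other on the outer operator; the second
  -- differences in Δ^s also need two.
  have hg : ∀ i, ∃ g, FracElasticity.HasSpectrum 2 (fun x => v x i) g := fun i =>
    FracElasticity.exists_hasSpectrum
      (((EuclideanSpace.proj i : EuclideanSpace ℝ (Fin n) →L[ℝ] ℝ).contDiff).comp hv)
      (hvc.comp_left (g := fun z : EuclideanSpace ℝ (Fin n) => z i) rfl) 2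
  choose g hg using hg
  let sym : Fin n → EuclideanSpace ℝ (Fin n) → ℂ := fun j =>
    FracElasticity.dirSymbol s (EuclideanSpace.single j 1)
  have hgrad : ∀ i j, FracElasticity.HasSpectrum 1 (fun x => FracElasticity.vecFracGrad s v x i j)
      (fun ξ => g i ξ * sym j ξ) := fun i j => by
    simp only [FracElasticity.vecFracGrad_apply]
    exact (hg i).dirDeriv hn hs0 hs1 _
  have hvi : ∀ x i j, Integrable fun y => FracElasticity.vecGradIntegrand s v x y i j :=
    fun x i j => by
      simp only [FracElasticity.vecGradIntegrand_apply]
      exact (((hg i).mono one_le_two).integrable_and_integral hn hs0 hs1 _ x).1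
  have htr : ∀ x, (FracElasticity.vecFracGrad s v x).trace = FracElasticity.fracDiv s v x :=
    fun x => FracElasticity.trace_vecFracGrad (hvi x)
  have hdiv : FracElasticity.HasSpectrum 1 (FracElasticity.fracDiv s v)
      (fun ξ => ∑ j, g j ξ * sym j ξ) := by
    have h := FracElasticity.HasSpectrum.sum Finset.univ fun j _ => hgrad j j
    have e : FracElasticity.fracDiv s v = fun x => ∑ j, FracElasticity.vecFracGrad s v x j j :=
      funext fun x => (htr x).symm
    rwa [e]
  have hone : ∀ i j, FracElasticity.HasSpectrum 1
      (fun x => (FracElasticity.fracDiv s v x • (1 : Matrix (Fin n) (Fin n) ℝ)) i j)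
      (fun ξ => if i = j then ∑ l, g l ξ * sym l ξ else 0) := fun i j => by
    rcases eq_or_ne i j with rfl | hij
    · simpa using hdiv
    · simp only [Matrix.smul_apply, Matrix.one_apply_ne hij, smul_zero, if_neg hij]
      exact ⟨aestronglyMeasurable_const, by simp, by simp⟩
  have hI := fun x => FracElasticity.integrable_matDivIntegrand_and_matFracDiv hn hs0 hs1 hone x
  have hD := fun x => FracElasticity.integrable_matDivIntegrand_and_matFracDiv hn hs0 hs1 hgrad x
  have hT := fun x => FracElasticity.integrable_matDivIntegrand_and_matFracDiv hn hs0 hs1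
    (Φ := fun y => (FracElasticity.vecFracGrad s v y)ᵀ) (fun i j => hgrad j i) x
  have hdivI : ∀ x, FracElasticity.matFracDiv s
      (fun y => FracElasticity.fracDiv s v y • (1 : Matrix (Fin n) (Fin n) ℝ)) x =
      FracElasticity.fracGrad s (FracElasticity.fracDiv s v) x := fun x => by
    rw [FracElasticity.matFracDiv, FracElasticity.fracGrad,
      FracElasticity.matDivIntegrand_smul_one]
  -- Taking div^s D^s v as the candidate limit yields at once the existence of the principal value
  -- and its identification.
  have hlap := fun x => FracElasticity.tendsto_truncLap hn hs0 hs1 hg hv.continuous hvc x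
    (FracElasticity.matFracDiv s (FracElasticity.vecFracGrad s v) x) fun i => by
      rw [(hD x).2 i]
      refine integral_congr_ae (.of_forall fun ξ => ?_)
      simp only
      rw [← FracElasticity.sum_dirSymbol_sq hs0 ξ, Finset.mul_sum]
      simp only [sym, mul_assoc]
  have hlim : ∀ x, FracElasticity.fracLap s v x =
      FracElasticity.matFracDiv s (FracElasticity.vecFracGrad s v) x := fun x =>
    (hlap x).2.limUnder_eq
  have htrans : ∀ x, FracElasticity.matFracDiv s
      (fun y => (FracElasticity.vecFracGrad s v y)ᵀ) x =
      FracElasticity.fracGrad s (FracElasticity.fracDiv s v) x := fun x => by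
    rw [← hdivI x]
    ext i
    rw [← Complex.ofReal_inj, (hT x).2 i, (hI x).2 i]
    refine integral_congr_ae (.of_forall fun ξ => ?_)
    -- Both sides become the sum over j of g_j times the symbols in directions i and j, differing
    -- only in the order of the factors.
    simp only [ite_mul, zero_mul, Finset.sum_ite_eq, Finset.mem_univ, if_true, Finset.sum_mul]
    refine Finset.sum_congr rfl fun j _ => ?_
    simp only [sym]
    ring
  have hiso : ∀ mu lam x,
      FracElasticity.matDivIntegrand s (fun y => FracElasticity.isoTensor mu lam
        (FracElasticity.symPart (FracElasticity.vecFracGrad s v y))) x =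
      fun y => mu • FracElasticity.matDivIntegrand s (FracElasticity.vecFracGrad s v) x y +
        mu • FracElasticity.matDivIntegrand s
          (fun y => (FracElasticity.vecFracGrad s v y)ᵀ) x y +
        lam • FracElasticity.matDivIntegrand s
          (fun y => FracElasticity.fracDiv s v y • (1 : Matrix (Fin n) (Fin n) ℝ)) x y := by
    intro mu lam x
    funext y
    ext i
    simp only [FracElasticity.isoTensor_symPart, htr, PiLp.add_apply, PiLp.smul_apply,
      FracElasticity.matDivIntegrand_apply, smul_eq_mul, Finset.mul_sum,
      ← Finset.sum_add_distrib, Matrix.add_apply, Matrix.smul_apply]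
    refine Finset.sum_congr rfl fun j _ => ?_
    ring
  have hnavier : ∀ mu lam x,
      Integrable (FracElasticity.matDivIntegrand s (fun y => FracElasticity.isoTensor mu lam
        (FracElasticity.symPart (FracElasticity.vecFracGrad s v y))) x) ∧
      FracElasticity.matFracDiv s (fun y => FracElasticity.isoTensor mu lam
        (FracElasticity.symPart (FracElasticity.vecFracGrad s v y))) x =
      mu • FracElasticity.fracLap s v x +
        (mu + lam) • FracElasticity.fracGrad s (FracElasticity.fracDiv s v) x := by
    intro mu lam x
    have i1 := (hD x).1.fun_smul mu
    have i2 := (hT x).1.fun_smul mu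
    have i3 := (hI x).1.fun_smul lam
    refine ⟨by rw [hiso]; exact (i1.fun_add i2).fun_add i3, ?_⟩
    -- The μ copy of D^s(div^s v) is read as the divergence of the transpose and the λ copy as that
    -- of (div^s v) I, matching the three terms of `hiso`.
    rw [add_smul, ← add_assoc, hlim, ← htrans x]
    nth_rewrite 2 [htrans x]
    rw [← hdivI x]
    simp only [FracElasticity.matFracDiv]
    rw [hiso, integral_add (i1.fun_add i2) i3, integral_add i1 i2, integral_smul, integral_smul,
      integral_smul]
    simp only [smul_add, smul_comm (FracElasticity.rieszConst n s)]
  refine ⟨fun x => ⟨hvi x, ?_, ?_, (hI x).1, (hD x).1, (hT x).1, (hlap x).1, ?_⟩, htr, hdivI,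
    fun x => (hlim x).symm, htrans, fun mu lam => ⟨hnavier mu lam, fun f => ?_⟩⟩
  · have e : FracElasticity.divIntegrand s v x =
        fun y => ∑ j, FracElasticity.vecGradIntegrand s v x y j j :=
      funext fun y => FracElasticity.divIntegrand_eq_sum s v x y
    rw [e]
    exact integrable_finsetSum _ fun j _ => hvi x j j
  · rw [← FracElasticity.matDivIntegrand_smul_one]
    exact (hI x).1
  · rw [hlim x]
    exact (hlap x).2
  · refine and_congr_left fun _ => forall₂_congr fun x _ => ?_
    rw [(hnavier mu lam x).2, neg_add, ← sub_eq_add_neg]
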